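/- **Setting.** Let $\mathcal L$ be a set of locations (with decidable equality). A *local language* is a set of expressions $e$ (with decidable equality) with variables, parallel substitution, free variables, a predicate "$e$ is a value", value expressions $\mathsf{true},\mathsf{false}$, and a step relation $e\to e'$, such that: substitution satisfies the usual laws ($x[\sigma]=\sigma(x)$, $e[\mathrm{id}]=e$, $e[\sigma][\sigma']=e[\sigma\sigma']$, renaming is substitution of variables); substituting only for variables that are not free in $e$ leaves $e$ unchanged; values are closed; values do not step. Fix a local language. All programs below are identified up to renaming of bound variables (formally, they are written with de Bruijn indices, with a separate namespace of local variables for each location), and all substitutions are capture-avoiding. **Choreographies.** With $d\in\{L,R\}$, $$C ::= X \mid \ell.e \mid \ell_1.e\rightsquigarrow\ell_2.x;\,C \mid \mathsf{if}\ \ell.e\ \mathsf{then}\ C_1\ \mathsf{else}\ C_2 \mid \ell_1[d]\rightsquigarrow\ell_2;\,C \mid \mathsf{let}\ \ell.x:=C_1\ \mathsf{in}\ C_2 \mid \mathsf{fun}_\ell\,F(x):=C \mid \mathsf{fun}\,F(X):=C \mid C\,(\ell.e) \mid C_1\,C_2 .$$ Functions may be recursive ($F$ is bound in the body). Values are $\ell.v$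 with $v$ a local value, and closed functions. The relation $C_1\xrightarrow{R}_B C_2$ ($R$ a redex, $B$ a set of blocked locations) is the least one such that: * if $e\to e'$ and $\ell\notin B$: $\ell.e\to\ell.e'$ with $R=\mathsf{Done}(\ell,e,e')$; $\mathsf{if}\ \ell.e\dots\to\mathsf{if}\ \ell.e'\dots$ with $R=\mathsf{IfE}(\ell,e,e')$; $C(\ell.e)\to C(\ell.e')$ with $R=\mathsf{AppLocalE}(\ell,e,e')$; and, if $\ell\ne\ell_2$, $(\ell.e\rightsquigarrow\ell_2.x;C)\to(\ell.e'\rightsquigarrow\ell_2.x;C)$ with $R=\mathsf{SendE}(\ell,e,e',\ell_2)$; * if $\ell_1\neq\ell_2$ and $\ell_1,\ell_2\notin B$: $(\ell_1.v\rightsquigarrow\ell_2.x;C)\to C[\ell_2.x\mapsto v]$ for a value $v$, with $R=\mathsf{SendV}(\ell_1,v,\ell_2)$; and $(\ell_1[d]\rightsquigarrow\ell_2;C)\to C$ with $R=\mathsf{Sync}(\ell_1,d,\ell_2)$; * if $\ell\notin B$: $\mathsf{if}\ \ell.\mathsf{true}\ \mathsf{then}\ C_1\ \mathsf{else}\ C_2\to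 C_1$ with $R=\mathsf{IfT}(\ell)$, and $\mathsf{if}\ \ell.\mathsf{false}\ \mathsf{then}\ C_1\ \mathsf{else}\ C_2\to C_2$ with $R=\mathsf{IfF}(\ell)$; * only for $B=\varnothing$, with $v$ and $V$ values: $\mathsf{let}\ \ell.x:=\ell.v\ \mathsf{in}\ C\to C[\ell.x\mapsto v]$ with $R=\mathsf{DefLocal}(\ell,v)$; $(\mathsf{fun}_\ell F(x):=C)(\ell.v)\to C[\ell.x\mapsto v][F\mapsto \mathsf{fun}_\ell F(x):=C]$ with $R=\mathsf{AppLocal}(\ell,v)$; $(\mathsf{fun}\,F(X):=C)\,V\to C[X\mapsto V,F\mapsto\mathsf{fun}\,F(X):=C]$ with $R=\mathsf{AppGlobal}$; * out-of-order steps: the continuation of $\ell_1.e\rightsquigarrow\ell_2.x$ or of $\ell_1[d]\rightsquigarrow\ell_2$ may step by $R$ under $B$ if it steps by $R$ under $B\cup\{\ell_1,\ell_2\}$; the two branches of an $\mathsf{if}$ at $\ell$ may step together by $R$ under $B$ if both step by the same $R$ under $B\cup\{\ell\}$; * if $C\xrightarrow{R}_B C'$, the whole program steps under $B$ by $\mathsf{Fun}(R)$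 when $C$ is in the function position of either kind of application, and by $\mathsf{Arg}(R)$ when $C$ is the argument of a global application or the bound choreography of a $\mathsf{let}$. **Control programs.** $$E ::= X\mid ()\mid \mathsf{ret}(e)\mid \mathsf{if}\ e\ \mathsf{then}\ E_1\ \mathsf{else}\ E_2\mid \mathsf{send}\ e\ \mathsf{to}\ \ell;E\mid \mathsf{recv}\ x\ \mathsf{from}\ \ell;E\mid \mathsf{choose}\ d\ \mathsf{for}\ \ell;E\mid \mathsf{allow}\ \ell\ \{\dots\}\mid \mathsf{let}\ \mathsf{ret}(x)=E_1\ \mathsf{in}\ E_2\mid \mathsf{fun_{loc}}\,F(x):=E\mid\mathsf{fun}\,F(X):=E\mid E\,e\mid E_1\,E_2,$$ where $\mathsf{allow}\ \ell$ has a left branch $\{L\Rightarrow E\}$, a right branch $\{R\Rightarrow E\}$, or both. Values are $()$, $\mathsf{ret}(v)$ with $v$ a local value, and closed functions. The labels are $l::=\iota\mid v!\ell\mid \ell?v\mid d!\ell\mid \ell?d\mid\iota_{\rm sync}\mid\mathsf{Fun}(l)\mid\mathsf{Arg}(l)$, and the steps $E\xrightarrow{l}E'$ are: a local step of the expression in $\mathsf{ret}$,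 $\mathsf{if}$, $\mathsf{send}$ or a local argument, and the reduction of $\mathsf{if}\ \mathsf{true}$ and $\mathsf{if}\ \mathsf{false}$ (label $\iota$); $\mathsf{send}\ v\ \mathsf{to}\ \ell;E\xrightarrow{v!\ell}E$ and $\mathsf{recv}\ x\ \mathsf{from}\ \ell;E\xrightarrow{\ell?v}E[x\mapsto v]$ for any value $v$; $\mathsf{choose}\ d\ \mathsf{for}\ \ell;E\xrightarrow{d!\ell}E$; $\mathsf{allow}\ \ell\{\dots\}\xrightarrow{\ell?d}$ its $d$-branch, if present; $\beta$-reduction with values of $\mathsf{let}\ \mathsf{ret}(x)=\mathsf{ret}(v)$ and of both kinds of applied function, substituting recursive functions for their names (label $\iota_{\rm sync}$); and a step with label $l$ in function position (label $\mathsf{Fun}(l)$), or in the argument of a global application or the bound program of a $\mathsf{let}$ (label $\mathsf{Arg}(l)$). **Merge.** The partial operation $E_1\sqcup E_2$ is defined if the two programs have the same outermost constructor with the same non-program data, and then merges the subprograms (all of these merges must be defined), except that functions merge only with themselves, and two $\mathsf{allow}\ \ell$ constructs (same $\ell$) merge into one having the branches present in either, a branch present in both being merged. **Projection.** The partial function $[\![C]\!]_\ell$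 is given by: $[\![X]\!]_\ell=X$; $[\![\ell_1.e]\!]_\ell=\mathsf{ret}(e)$ if $\ell_1=\ell$, else $()$; $\ell_1.e\rightsquigarrow\ell_2.x;C$ gives $\mathsf{send}\ e\ \mathsf{to}\ \ell_2;[\![C]\!]_\ell$ if $\ell=\ell_1\neq\ell_2$, $\mathsf{recv}\ x\ \mathsf{from}\ \ell_1;[\![C]\!]_\ell$ if $\ell=\ell_2\ne\ell_1$, undefined if $\ell=\ell_1=\ell_2$, else $[\![C]\!]_\ell$; $\ell_1[d]\rightsquigarrow\ell_2;C$ gives in the same four cases $\mathsf{choose}\ d\ \mathsf{for}\ \ell_2;[\![C]\!]_\ell$, $\mathsf{allow}\ \ell_1\{d\Rightarrow[\![C]\!]_\ell\}$, undefined, $[\![C]\!]_\ell$; $\mathsf{if}\ \ell_1.e$ gives $\mathsf{if}\ e\ \mathsf{then}\ [\![C_1]\!]_\ell\ \mathsf{else}\ [\![C_2]\!]_\ell$ if $\ell_1=\ell$, else $[\![C_1]\!]_\ell\sqcup[\![C_2]\!]_\ell$; $\mathsf{let}\ \ell_1.x:=C_1\ \mathsf{in}\ C_2$ gives $\mathsf{let}\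 \mathsf{ret}(x)=[\![C_1]\!]_\ell\ \mathsf{in}\ [\![C_2]\!]_\ell$ if $\ell_1=\ell$, else $(\mathsf{fun}\,F(X):=[\![C_2]\!]_\ell)\,[\![C_1]\!]_\ell$ with $F,X$ fresh; $\mathsf{fun}_{\ell_1}F(x):=C$ gives $\mathsf{fun_{loc}}F(x):=[\![C]\!]_\ell$ if $\ell_1=\ell$, else $\mathsf{fun}\,F(X):=[\![C]\!]_\ell$ with $X$ fresh; $C(\ell_1.e)$ gives $[\![C]\!]_\ell\,e$ if $\ell_1=\ell$, else $[\![C]\!]_\ell\,()$; global functions and applications are projected componentwise. It is undefined if a subprojection or merge it uses is undefined. For redices, the partial function $[\![R]\!]_\ell$ is: $\iota$ for $\mathsf{Done},\mathsf{IfE},\mathsf{IfT},\mathsf{IfF},\mathsf{AppLocalE},\mathsf{SendE}$ whose acting (first) location is $\ell$; for $\mathsf{SendV}(\ell_1,v,\ell_2)$, $v!\ell_2$ if $\ell=\ell_1\ne\ell_2$ and $\ell_1?v$ if $\ell=\ell_2\neq\ell_1$; for $\mathsf{Sync}(\ell_1,d,\ell_2)$, $d!\ell_2$ and $\ell_1?d$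 in the same cases; $\iota_{\rm sync}$ for $\mathsf{DefLocal},\mathsf{AppLocal},\mathsf{AppGlobal}$; $[\![\mathsf{Arg}(R)]\!]_\ell=\mathsf{Arg}([\![R]\!]_\ell)$ and $[\![\mathsf{Fun}(R)]\!]_\ell=\mathsf{Fun}([\![R]\!]_\ell)$; undefined in all other cases. **Less nondeterminism.** $E_1\preceq E_2$ is the least relation compatible with all constructors of control programs, except that functions are related only to themselves, and such that $E\preceq E_L$ implies $\mathsf{allow}\ \ell\{L\Rightarrow E\}\preceq\mathsf{allow}\ \ell\{L\Rightarrow E_L;R\Rightarrow E_R\}$, and symmetrically for $R$. **Theorem (Local Completeness).** Suppose $C_1\xrightarrow{R}_B C_2$, and let $\ell$ be any location such that $[\![C_1]\!]_\ell$ is defined. Then $[\![C_2]\!]_\ell$ is defined, and either (a) $[\![R]\!]_\ell$ is defined and $[\![C_1]\!]_\ell\xrightarrow{[\![R]\!]_\ell}[\![C_2]\!]_\ell$, or (b) $[\![R]\!]_\ell$ is undefined and $[\![C_2]\!]_\ell\preceq[\![C_1]\!]_\ell$. -/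

import Mathlib

/-!
Choreographies, control programs and endpoint projection, in nameless (de Bruijn) style over a
generic local language.  Every location has its own namespace of local variables, and there is one
further namespace of choreography (respectively control) variables; each namespace has its own
indices.  A binder only shifts the namespace it binds in.
-/

namespace Pirouette

universe u v

/-- The requirements on the language of local programs, in nameless form.  `subst e σ` is infinite
parallel substitution, `ren e ξ` is renaming, and `ClosedBelow n e` says that all free variables of
`e` are among the indices `0, …, n - 1`. -/
class LocalLanguage (Expr : Type v) where
  var : ℕ → Expr
  ClosedBelow : ℕ → Expr → Prop
  subst : Expr → (ℕ → Expr) → Expr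
  ren : Expr → (ℕ → ℕ) → Expr
  Value : Expr → Prop
  tt : Expr
  ff : Expr
  Step : Expr → Expr → Prop
  closedBelow_var : ∀ n m, ClosedBelow n (var m) ↔ m < n
  subst_var : ∀ n σ, subst (var n) σ = σ n
  subst_id : ∀ e, subst e var = e
  subst_subst : ∀ e σ₁ σ₂, subst (subst e σ₁) σ₂ = subst e (fun n => subst (σ₁ n) σ₂)
  ren_eq_subst : ∀ e ξ, ren e ξ = subst e (fun n => var (ξ n))
  /-- Substituting only for variables that do not occur free changes nothing. -/
  subst_closedBelow : ∀ n e σ, ClosedBelow n e → (∀ m, m < n → σ m = var m) → subst e σ = e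
  value_tt : Value tt
  value_ff : Value ff
  value_closed : ∀ v, Value v → ClosedBelow 0 v
  value_not_step : ∀ v e, Value v → ¬ Step v e

/-- The renaming `ξ` pushed under one binder. -/
def upRen (ξ : ℕ → ℕ) : ℕ → ℕ
  | 0 => 0
  | n + 1 => ξ n + 1

/-- The local substitution `σ` pushed under one local binder. -/
def upSubst {Expr : Type v} [LocalLanguage Expr] (σ : ℕ → Expr) : ℕ → Expr
  | 0 => LocalLanguage.var 0
  | n + 1 => LocalLanguage.ren (σ n) Nat.succ

/-- The substitution of `e` for the most recently bound local variable. -/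
def singleSubst {Expr : Type v} [LocalLanguage Expr] (e : Expr) : ℕ → Expr
  | 0 => e
  | n + 1 => LocalLanguage.var n

/-- Synchronization labels. -/
inductive Choice : Type
  | left
  | right
  deriving DecidableEq

/-! ### Choreographies -/

/-- Choreographies.  Binding structure:
* `send ℓ₁ e ℓ₂ C` binds local variable `0` of `ℓ₂` in `C`;
* `defLocal ℓ C₁ C₂` binds local variable `0` of `ℓ` in `C₂`;
* `funLocal ℓ C` binds local variable `0` of `ℓ` (the argument) and choreography variable `0`
  (the function itself) in `C`;
* `funGlobal C` binds choreography variables `0` (the argument) and `1` (the function itself). -/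
inductive Chor (Loc : Type u) (Expr : Type v) : Type (max u v)
  | var (n : ℕ)
  | done (ℓ : Loc) (e : Expr)
  | send (ℓ₁ : Loc) (e : Expr) (ℓ₂ : Loc) (C : Chor Loc Expr)
  | ite (ℓ : Loc) (e : Expr) (C₁ C₂ : Chor Loc Expr)
  | sync (ℓ₁ : Loc) (d : Choice) (ℓ₂ : Loc) (C : Chor Loc Expr)
  | defLocal (ℓ : Loc) (C₁ C₂ : Chor Loc Expr)
  | funLocal (ℓ : Loc) (C : Chor Loc Expr)
  | funGlobal (C : Chor Loc Expr)
  | appLocal (ℓ : Loc) (C : Chor Loc Expr) (e : Expr)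
  | appGlobal (C₁ C₂ : Chor Loc Expr)

section LocFamilies

variable {Loc : Type u} {Expr : Type v} [DecidableEq Loc] [LocalLanguage Expr]

/-- A family of local renamings pushed under a binder for a local variable of `ℓ`. -/
def upLocRen (ℓ : Loc) (ξ : Loc → ℕ → ℕ) : Loc → ℕ → ℕ :=
  fun ℓ' => if ℓ' = ℓ then upRen (ξ ℓ') else ξ ℓ'

/-- The family of local renamings that makes room for a new local variable `0` of `ℓ`. -/
def shiftLoc (ℓ : Loc) : Loc → ℕ → ℕ :=
  fun ℓ' => if ℓ' = ℓ then Nat.succ else id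

/-- A family of local substitutions pushed under a binder for a local variable of `ℓ`. -/
def upLocSubst (ℓ : Loc) (σ : Loc → ℕ → Expr) : Loc → ℕ → Expr :=
  fun ℓ' => if ℓ' = ℓ then upSubst (σ ℓ') else σ ℓ'

/-- The substitution of `e` for the most recently bound local variable of `ℓ`. -/
def singleLocSubst (ℓ : Loc) (e : Expr) : Loc → ℕ → Expr :=
  fun ℓ' => if ℓ' = ℓ then singleSubst e else LocalLanguage.var

/-- A family of bounds on free local variables, under a binder for a local variable of `ℓ`. -/
def upLocBound (ℓ : Loc) (n : Loc → ℕ) : Loc → ℕ :=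
  fun ℓ' => if ℓ' = ℓ then n ℓ' + 1 else n ℓ'

end LocFamilies

namespace Chor

variable {Loc : Type u} {Expr : Type v} [DecidableEq Loc] [LocalLanguage Expr]

/-- Renaming of local variables. -/
def lren : Chor Loc Expr → (Loc → ℕ → ℕ) → Chor Loc Expr
  | var n, _ => var n
  | done ℓ e, ξ => done ℓ (LocalLanguage.ren e (ξ ℓ))
  | send ℓ₁ e ℓ₂ C, ξ => send ℓ₁ (LocalLanguage.ren e (ξ ℓ₁)) ℓ₂ (C.lren (upLocRen ℓ₂ ξ))
  | ite ℓ e C₁ C₂, ξ => ite ℓ (LocalLanguage.ren e (ξ ℓ)) (C₁.lren ξ) (C₂.lren ξ)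
  | sync ℓ₁ d ℓ₂ C, ξ => sync ℓ₁ d ℓ₂ (C.lren ξ)
  | defLocal ℓ C₁ C₂, ξ => defLocal ℓ (C₁.lren ξ) (C₂.lren (upLocRen ℓ ξ))
  | funLocal ℓ C, ξ => funLocal ℓ (C.lren (upLocRen ℓ ξ))
  | funGlobal C, ξ => funGlobal (C.lren ξ)
  | appLocal ℓ C e, ξ => appLocal ℓ (C.lren ξ) (LocalLanguage.ren e (ξ ℓ))
  | appGlobal C₁ C₂, ξ => appGlobal (C₁.lren ξ) (C₂.lren ξ)

/-- Substitution for local variables. -/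
def lsubst : Chor Loc Expr → (Loc → ℕ → Expr) → Chor Loc Expr
  | var n, _ => var n
  | done ℓ e, σ => done ℓ (LocalLanguage.subst e (σ ℓ))
  | send ℓ₁ e ℓ₂ C, σ =>
      send ℓ₁ (LocalLanguage.subst e (σ ℓ₁)) ℓ₂ (C.lsubst (upLocSubst ℓ₂ σ))
  | ite ℓ e C₁ C₂, σ => ite ℓ (LocalLanguage.subst e (σ ℓ)) (C₁.lsubst σ) (C₂.lsubst σ)
  | sync ℓ₁ d ℓ₂ C, σ => sync ℓ₁ d ℓ₂ (C.lsubst σ)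
  | defLocal ℓ C₁ C₂, σ => defLocal ℓ (C₁.lsubst σ) (C₂.lsubst (upLocSubst ℓ σ))
  | funLocal ℓ C, σ => funLocal ℓ (C.lsubst (upLocSubst ℓ σ))
  | funGlobal C, σ => funGlobal (C.lsubst σ)
  | appLocal ℓ C e, σ => appLocal ℓ (C.lsubst σ) (LocalLanguage.subst e (σ ℓ))
  | appGlobal C₁ C₂, σ => appGlobal (C₁.lsubst σ) (C₂.lsubst σ)

/-- Renaming of choreography variables. -/
def gren : Chor Loc Expr → (ℕ → ℕ) → Chor Loc Expr
  | var n, ξ => var (ξ n)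
  | done ℓ e, _ => done ℓ e
  | send ℓ₁ e ℓ₂ C, ξ => send ℓ₁ e ℓ₂ (C.gren ξ)
  | ite ℓ e C₁ C₂, ξ => ite ℓ e (C₁.gren ξ) (C₂.gren ξ)
  | sync ℓ₁ d ℓ₂ C, ξ => sync ℓ₁ d ℓ₂ (C.gren ξ)
  | defLocal ℓ C₁ C₂, ξ => defLocal ℓ (C₁.gren ξ) (C₂.gren ξ)
  | funLocal ℓ C, ξ => funLocal ℓ (C.gren (upRen ξ))
  | funGlobal C, ξ => funGlobal (C.gren (upRen (upRen ξ)))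
  | appLocal ℓ C e, ξ => appLocal ℓ (C.gren ξ) e
  | appGlobal C₁ C₂, ξ => appGlobal (C₁.gren ξ) (C₂.gren ξ)

/-- A substitution for choreography variables pushed under a choreography-variable binder. -/
def upG (σ : ℕ → Chor Loc Expr) : ℕ → Chor Loc Expr
  | 0 => var 0
  | n + 1 => (σ n).gren Nat.succ

/-- A substitution for choreography variables pushed under a binder for a local variable of `ℓ`. -/
def upGLoc (ℓ : Loc) (σ : ℕ → Chor Loc Expr) : ℕ → Chor Loc Expr :=
  fun n => (σ n).lren (shiftLoc ℓ)

/-- Capture-avoiding substitution for choreography variables. -/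
def gsubst : Chor Loc Expr → (ℕ → Chor Loc Expr) → Chor Loc Expr
  | var n, σ => σ n
  | done ℓ e, _ => done ℓ e
  | send ℓ₁ e ℓ₂ C, σ => send ℓ₁ e ℓ₂ (C.gsubst (upGLoc ℓ₂ σ))
  | ite ℓ e C₁ C₂, σ => ite ℓ e (C₁.gsubst σ) (C₂.gsubst σ)
  | sync ℓ₁ d ℓ₂ C, σ => sync ℓ₁ d ℓ₂ (C.gsubst σ)
  | defLocal ℓ C₁ C₂, σ => defLocal ℓ (C₁.gsubst σ) (C₂.gsubst (upGLoc ℓ σ))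
  | funLocal ℓ C, σ => funLocal ℓ (C.gsubst (upG (upGLoc ℓ σ)))
  | funGlobal C, σ => funGlobal (C.gsubst (upG (upG σ)))
  | appLocal ℓ C e, σ => appLocal ℓ (C.gsubst σ) e
  | appGlobal C₁ C₂, σ => appGlobal (C₁.gsubst σ) (C₂.gsubst σ)

/-- The substitution of `D` for choreography variable `0`. -/
def single (D : Chor Loc Expr) : ℕ → Chor Loc Expr
  | 0 => D
  | n + 1 => var n

/-- The substitution of `D₀` for choreography variable `0` and `D₁` for variable `1`. -/
def double (D₀ D₁ : Chor Loc Expr) : ℕ → Chor Loc Expr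
  | 0 => D₀
  | 1 => D₁
  | n + 2 => var n

/-- `C.ClosedBelow n m`: the free local variables of `C` at each location `ℓ` are below `n ℓ`, and
its free choreography variables are below `m`. -/
def ClosedBelow : Chor Loc Expr → (Loc → ℕ) → ℕ → Prop
  | var k, _, m => k < m
  | done ℓ e, n, _ => LocalLanguage.ClosedBelow (n ℓ) e
  | send ℓ₁ e ℓ₂ C, n, m =>
      LocalLanguage.ClosedBelow (n ℓ₁) e ∧ C.ClosedBelow (upLocBound ℓ₂ n) m
  | ite ℓ e C₁ C₂, n, m =>
      LocalLanguage.ClosedBelow (n ℓ) e ∧ C₁.ClosedBelow n m ∧ C₂.ClosedBelow n m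
  | sync _ _ _ C, n, m => C.ClosedBelow n m
  | defLocal ℓ C₁ C₂, n, m => C₁.ClosedBelow n m ∧ C₂.ClosedBelow (upLocBound ℓ n) m
  | funLocal ℓ C, n, m => C.ClosedBelow (upLocBound ℓ n) (m + 1)
  | funGlobal C, n, m => C.ClosedBelow n (m + 2)
  | appLocal ℓ C e, n, m => C.ClosedBelow n m ∧ LocalLanguage.ClosedBelow (n ℓ) e
  | appGlobal C₁ C₂, n, m => C₁.ClosedBelow n m ∧ C₂.ClosedBelow n m

/-- Choreography values: located local values and closed functions. -/
inductive Value : Chor Loc Expr → Prop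
  | done (ℓ : Loc) (v : Expr) : LocalLanguage.Value v → Value (done ℓ v)
  | funLocal (ℓ : Loc) (C : Chor Loc Expr) :
      (Chor.funLocal ℓ C).ClosedBelow (fun _ => 0) 0 → Value (Chor.funLocal ℓ C)
  | funGlobal (C : Chor Loc Expr) :
      (Chor.funGlobal C).ClosedBelow (fun _ => 0) 0 → Value (Chor.funGlobal C)

end Chor

/-- Redices, the labels of choreography steps. -/
inductive Redex (Loc : Type u) (Expr : Type v) : Type (max u v)
  | done (ℓ : Loc) (e₁ e₂ : Expr)
  | ifE (ℓ : Loc) (e₁ e₂ : Expr)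
  | ifT (ℓ : Loc)
  | ifF (ℓ : Loc)
  | sendE (ℓ₁ : Loc) (e₁ e₂ : Expr) (ℓ₂ : Loc)
  | sendV (ℓ₁ : Loc) (v : Expr) (ℓ₂ : Loc)
  | sync (ℓ₁ : Loc) (d : Choice) (ℓ₂ : Loc)
  | defLocal (ℓ : Loc) (v : Expr)
  | appLocalE (ℓ : Loc) (e₁ e₂ : Expr)
  | appLocal (ℓ : Loc) (v : Expr)
  | appGlobal
  | arg (R : Redex Loc Expr)
  | func (R : Redex Loc Expr)

/-- `ChorStep R B C₁ C₂`: the choreography `C₁` steps to `C₂` by the redex `R` while every location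
in `B` is blocked. -/
inductive ChorStep {Loc : Type u} {Expr : Type v} [DecidableEq Loc] [LocalLanguage Expr] :
    Redex Loc Expr → Set Loc → Chor Loc Expr → Chor Loc Expr → Prop
  | doneE {B : Set Loc} {ℓ : Loc} {e₁ e₂ : Expr} :
      ℓ ∉ B → LocalLanguage.Step e₁ e₂ →
      ChorStep (.done ℓ e₁ e₂) B (.done ℓ e₁) (.done ℓ e₂)
  | sendE {B : Set Loc} {ℓ₁ ℓ₂ : Loc} {e₁ e₂ : Expr} {C : Chor Loc Expr} :
      ℓ₁ ∉ B → ℓ₁ ≠ ℓ₂ → LocalLanguage.Step e₁ e₂ →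
      ChorStep (.sendE ℓ₁ e₁ e₂ ℓ₂) B (.send ℓ₁ e₁ ℓ₂ C) (.send ℓ₁ e₂ ℓ₂ C)
  | sendI {R : Redex Loc Expr} {B : Set Loc} {ℓ₁ ℓ₂ : Loc} {e : Expr} {C₁ C₂ : Chor Loc Expr} :
      ChorStep R (B ∪ {ℓ₁, ℓ₂}) C₁ C₂ →
      ChorStep R B (.send ℓ₁ e ℓ₂ C₁) (.send ℓ₁ e ℓ₂ C₂)
  | sendV {B : Set Loc} {ℓ₁ ℓ₂ : Loc} {v : Expr} {C : Chor Loc Expr} :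
      ℓ₁ ∉ B → ℓ₂ ∉ B → LocalLanguage.Value v → ℓ₁ ≠ ℓ₂ →
      ChorStep (.sendV ℓ₁ v ℓ₂) B (.send ℓ₁ v ℓ₂ C) (C.lsubst (singleLocSubst ℓ₂ v))
  | ifE {B : Set Loc} {ℓ : Loc} {e₁ e₂ : Expr} {C₁ C₂ : Chor Loc Expr} :
      ℓ ∉ B → LocalLanguage.Step e₁ e₂ →
      ChorStep (.ifE ℓ e₁ e₂) B (.ite ℓ e₁ C₁ C₂) (.ite ℓ e₂ C₁ C₂)
  | ifI {R : Redex Loc Expr} {B : Set Loc} {ℓ : Loc} {e : Expr} {C₁ C₁' C₂ C₂' : Chor Loc Expr} :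
      ChorStep R (B ∪ {ℓ}) C₁ C₁' → ChorStep R (B ∪ {ℓ}) C₂ C₂' →
      ChorStep R B (.ite ℓ e C₁ C₂) (.ite ℓ e C₁' C₂')
  | ifT {B : Set Loc} {ℓ : Loc} {C₁ C₂ : Chor Loc Expr} :
      ℓ ∉ B → ChorStep (.ifT ℓ) B (.ite ℓ LocalLanguage.tt C₁ C₂) C₁
  | ifF {B : Set Loc} {ℓ : Loc} {C₁ C₂ : Chor Loc Expr} :
      ℓ ∉ B → ChorStep (.ifF ℓ) B (.ite ℓ LocalLanguage.ff C₁ C₂) C₂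
  | defLocalI {R : Redex Loc Expr} {B : Set Loc} {ℓ : Loc} {C₁ C₁' C₂ : Chor Loc Expr} :
      ChorStep R B C₁ C₁' →
      ChorStep (.arg R) B (.defLocal ℓ C₁ C₂) (.defLocal ℓ C₁' C₂)
  | defLocal {ℓ : Loc} {v : Expr} {C : Chor Loc Expr} :
      LocalLanguage.Value v →
      ChorStep (.defLocal ℓ v) ∅ (.defLocal ℓ (.done ℓ v) C) (C.lsubst (singleLocSubst ℓ v))
  | appLocalFun {R : Redex Loc Expr} {B : Set Loc} {ℓ : Loc} {C₁ C₂ : Chor Loc Expr} {e : Expr} :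
      ChorStep R B C₁ C₂ →
      ChorStep (.func R) B (.appLocal ℓ C₁ e) (.appLocal ℓ C₂ e)
  | appLocalArg {B : Set Loc} {ℓ : Loc} {C : Chor Loc Expr} {e₁ e₂ : Expr} :
      ℓ ∉ B → LocalLanguage.Step e₁ e₂ →
      ChorStep (.appLocalE ℓ e₁ e₂) B (.appLocal ℓ C e₁) (.appLocal ℓ C e₂)
  | appLocal {ℓ : Loc} {C : Chor Loc Expr} {v : Expr} :
      LocalLanguage.Value v →
      ChorStep (.appLocal ℓ v) ∅ (.appLocal ℓ (.funLocal ℓ C) v)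
        ((C.lsubst (singleLocSubst ℓ v)).gsubst (Chor.single (.funLocal ℓ C)))
  | appGlobalFun {R : Redex Loc Expr} {B : Set Loc} {C₁ C₁' C₂ : Chor Loc Expr} :
      ChorStep R B C₁ C₁' →
      ChorStep (.func R) B (.appGlobal C₁ C₂) (.appGlobal C₁' C₂)
  | appGlobalArg {R : Redex Loc Expr} {B : Set Loc} {C₁ C₂ C₂' : Chor Loc Expr} :
      ChorStep R B C₂ C₂' →
      ChorStep (.arg R) B (.appGlobal C₁ C₂) (.appGlobal C₁ C₂')
  | appGlobal {C V : Chor Loc Expr} :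
      V.Value →
      ChorStep .appGlobal ∅ (.appGlobal (.funGlobal C) V)
        (C.gsubst (Chor.double V (.funGlobal C)))
  | syncI {R : Redex Loc Expr} {B : Set Loc} {ℓ₁ ℓ₂ : Loc} {d : Choice} {C₁ C₂ : Chor Loc Expr} :
      ChorStep R (B ∪ {ℓ₁, ℓ₂}) C₁ C₂ →
      ChorStep R B (.sync ℓ₁ d ℓ₂ C₁) (.sync ℓ₁ d ℓ₂ C₂)
  | sync {B : Set Loc} {ℓ₁ ℓ₂ : Loc} {d : Choice} {C : Chor Loc Expr} :
      ℓ₁ ∉ B → ℓ₂ ∉ B → ℓ₁ ≠ ℓ₂ →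
      ChorStep (.sync ℓ₁ d ℓ₂) B (.sync ℓ₁ d ℓ₂ C) C

/-! ### Control programs -/

/-- Control programs.  `allowLR ℓ E₁ E₂` lets `ℓ` choose between `E₁` (left) and `E₂` (right);
`allowL` and `allowR` are the one-branch versions.  Binding structure:
* `recv ℓ E` binds local variable `0` in `E`;
* `letRet E₁ E₂` binds local variable `0` in `E₂`;
* `funLocal E` binds local variable `0` (the argument) and control variable `0` (the function);
* `funGlobal E` binds control variables `0` (the argument) and `1` (the function). -/
inductive Ctrl (Loc : Type u) (Expr : Type v) : Type (max u v)
  | var (n : ℕ)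
  | unit
  | ret (e : Expr)
  | ite (e : Expr) (E₁ E₂ : Ctrl Loc Expr)
  | send (e : Expr) (ℓ : Loc) (E : Ctrl Loc Expr)
  | recv (ℓ : Loc) (E : Ctrl Loc Expr)
  | choose (d : Choice) (ℓ : Loc) (E : Ctrl Loc Expr)
  | allowL (ℓ : Loc) (E : Ctrl Loc Expr)
  | allowR (ℓ : Loc) (E : Ctrl Loc Expr)
  | allowLR (ℓ : Loc) (E₁ E₂ : Ctrl Loc Expr)
  | letRet (E₁ E₂ : Ctrl Loc Expr)
  | funLocal (E : Ctrl Loc Expr)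
  | funGlobal (E : Ctrl Loc Expr)
  | appLocal (E : Ctrl Loc Expr) (e : Expr)
  | appGlobal (E₁ E₂ : Ctrl Loc Expr)
  deriving DecidableEq

namespace Ctrl

variable {Loc : Type u} {Expr : Type v} [LocalLanguage Expr]

/-- Renaming of local variables. -/
def lren : Ctrl Loc Expr → (ℕ → ℕ) → Ctrl Loc Expr
  | var n, _ => var n
  | unit, _ => unit
  | ret e, ξ => ret (LocalLanguage.ren e ξ)
  | ite e E₁ E₂, ξ => ite (LocalLanguage.ren e ξ) (E₁.lren ξ) (E₂.lren ξ)
  | send e ℓ E, ξ => send (LocalLanguage.ren e ξ) ℓ (E.lren ξ)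
  | recv ℓ E, ξ => recv ℓ (E.lren (upRen ξ))
  | choose d ℓ E, ξ => choose d ℓ (E.lren ξ)
  | allowL ℓ E, ξ => allowL ℓ (E.lren ξ)
  | allowR ℓ E, ξ => allowR ℓ (E.lren ξ)
  | allowLR ℓ E₁ E₂, ξ => allowLR ℓ (E₁.lren ξ) (E₂.lren ξ)
  | letRet E₁ E₂, ξ => letRet (E₁.lren ξ) (E₂.lren (upRen ξ))
  | funLocal E, ξ => funLocal (E.lren (upRen ξ))
  | funGlobal E, ξ => funGlobal (E.lren ξ)
  | appLocal E e, ξ => appLocal (E.lren ξ) (LocalLanguage.ren e ξ)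
  | appGlobal E₁ E₂, ξ => appGlobal (E₁.lren ξ) (E₂.lren ξ)

/-- Substitution for local variables. -/
def lsubst : Ctrl Loc Expr → (ℕ → Expr) → Ctrl Loc Expr
  | var n, _ => var n
  | unit, _ => unit
  | ret e, σ => ret (LocalLanguage.subst e σ)
  | ite e E₁ E₂, σ => ite (LocalLanguage.subst e σ) (E₁.lsubst σ) (E₂.lsubst σ)
  | send e ℓ E, σ => send (LocalLanguage.subst e σ) ℓ (E.lsubst σ)
  | recv ℓ E, σ => recv ℓ (E.lsubst (upSubst σ))
  | choose d ℓ E, σ => choose d ℓ (E.lsubst σ)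
  | allowL ℓ E, σ => allowL ℓ (E.lsubst σ)
  | allowR ℓ E, σ => allowR ℓ (E.lsubst σ)
  | allowLR ℓ E₁ E₂, σ => allowLR ℓ (E₁.lsubst σ) (E₂.lsubst σ)
  | letRet E₁ E₂, σ => letRet (E₁.lsubst σ) (E₂.lsubst (upSubst σ))
  | funLocal E, σ => funLocal (E.lsubst (upSubst σ))
  | funGlobal E, σ => funGlobal (E.lsubst σ)
  | appLocal E e, σ => appLocal (E.lsubst σ) (LocalLanguage.subst e σ)
  | appGlobal E₁ E₂, σ => appGlobal (E₁.lsubst σ) (E₂.lsubst σ)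

/-- Renaming of control variables. -/
def gren : Ctrl Loc Expr → (ℕ → ℕ) → Ctrl Loc Expr
  | var n, ξ => var (ξ n)
  | unit, _ => unit
  | ret e, _ => ret e
  | ite e E₁ E₂, ξ => ite e (E₁.gren ξ) (E₂.gren ξ)
  | send e ℓ E, ξ => send e ℓ (E.gren ξ)
  | recv ℓ E, ξ => recv ℓ (E.gren ξ)
  | choose d ℓ E, ξ => choose d ℓ (E.gren ξ)
  | allowL ℓ E, ξ => allowL ℓ (E.gren ξ)
  | allowR ℓ E, ξ => allowR ℓ (E.gren ξ)
  | allowLR ℓ E₁ E₂, ξ => allowLR ℓ (E₁.gren ξ) (E₂.gren ξ)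
  | letRet E₁ E₂, ξ => letRet (E₁.gren ξ) (E₂.gren ξ)
  | funLocal E, ξ => funLocal (E.gren (upRen ξ))
  | funGlobal E, ξ => funGlobal (E.gren (upRen (upRen ξ)))
  | appLocal E e, ξ => appLocal (E.gren ξ) e
  | appGlobal E₁ E₂, ξ => appGlobal (E₁.gren ξ) (E₂.gren ξ)

/-- A substitution for control variables pushed under a control-variable binder. -/
def upG (σ : ℕ → Ctrl Loc Expr) : ℕ → Ctrl Loc Expr
  | 0 => var 0
  | n + 1 => (σ n).gren Nat.succ

/-- A substitution for control variables pushed under a local-variable binder. -/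
def upGLoc (σ : ℕ → Ctrl Loc Expr) : ℕ → Ctrl Loc Expr :=
  fun n => (σ n).lren Nat.succ

/-- Capture-avoiding substitution for control variables. -/
def gsubst : Ctrl Loc Expr → (ℕ → Ctrl Loc Expr) → Ctrl Loc Expr
  | var n, σ => σ n
  | unit, _ => unit
  | ret e, _ => ret e
  | ite e E₁ E₂, σ => ite e (E₁.gsubst σ) (E₂.gsubst σ)
  | send e ℓ E, σ => send e ℓ (E.gsubst σ)
  | recv ℓ E, σ => recv ℓ (E.gsubst (upGLoc σ))
  | choose d ℓ E, σ => choose d ℓ (E.gsubst σ)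
  | allowL ℓ E, σ => allowL ℓ (E.gsubst σ)
  | allowR ℓ E, σ => allowR ℓ (E.gsubst σ)
  | allowLR ℓ E₁ E₂, σ => allowLR ℓ (E₁.gsubst σ) (E₂.gsubst σ)
  | letRet E₁ E₂, σ => letRet (E₁.gsubst σ) (E₂.gsubst (upGLoc σ))
  | funLocal E, σ => funLocal (E.gsubst (upG (upGLoc σ)))
  | funGlobal E, σ => funGlobal (E.gsubst (upG (upG σ)))
  | appLocal E e, σ => appLocal (E.gsubst σ) e
  | appGlobal E₁ E₂, σ => appGlobal (E₁.gsubst σ) (E₂.gsubst σ)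

/-- The substitution of `D` for control variable `0`. -/
def single (D : Ctrl Loc Expr) : ℕ → Ctrl Loc Expr
  | 0 => D
  | n + 1 => var n

/-- The substitution of `D₀` for control variable `0` and `D₁` for variable `1`. -/
def double (D₀ D₁ : Ctrl Loc Expr) : ℕ → Ctrl Loc Expr
  | 0 => D₀
  | 1 => D₁
  | n + 2 => var n

/-- `E.ClosedBelow n m`: the free local variables of `E` are below `n` and its free control
variables are below `m`. -/
def ClosedBelow : Ctrl Loc Expr → ℕ → ℕ → Prop
  | var k, _, m => k < m
  | unit, _, _ => True
  | ret e, n, _ => LocalLanguage.ClosedBelow n e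
  | ite e E₁ E₂, n, m =>
      LocalLanguage.ClosedBelow n e ∧ E₁.ClosedBelow n m ∧ E₂.ClosedBelow n m
  | send e _ E, n, m => LocalLanguage.ClosedBelow n e ∧ E.ClosedBelow n m
  | recv _ E, n, m => E.ClosedBelow (n + 1) m
  | choose _ _ E, n, m => E.ClosedBelow n m
  | allowL _ E, n, m => E.ClosedBelow n m
  | allowR _ E, n, m => E.ClosedBelow n m
  | allowLR _ E₁ E₂, n, m => E₁.ClosedBelow n m ∧ E₂.ClosedBelow n m
  | letRet E₁ E₂, n, m => E₁.ClosedBelow n m ∧ E₂.ClosedBelow (n + 1) m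
  | funLocal E, n, m => E.ClosedBelow (n + 1) (m + 1)
  | funGlobal E, n, m => E.ClosedBelow n (m + 2)
  | appLocal E e, n, m => E.ClosedBelow n m ∧ LocalLanguage.ClosedBelow n e
  | appGlobal E₁ E₂, n, m => E₁.ClosedBelow n m ∧ E₂.ClosedBelow n m

/-- Control values: the trivial value, returned local values, and closed functions. -/
inductive Value : Ctrl Loc Expr → Prop
  | unit : Value unit
  | ret (v : Expr) : LocalLanguage.Value v → Value (ret v)
  | funLocal (E : Ctrl Loc Expr) :
      (Ctrl.funLocal E).ClosedBelow 0 0 → Value (Ctrl.funLocal E)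
  | funGlobal (E : Ctrl Loc Expr) :
      (Ctrl.funGlobal E).ClosedBelow 0 0 → Value (Ctrl.funGlobal E)

end Ctrl

/-- Labels of control-program steps. -/
inductive Label (Loc : Type u) (Expr : Type v) : Type (max u v)
  | tau
  | send (v : Expr) (ℓ : Loc)
  | recv (ℓ : Loc) (v : Expr)
  | choose (d : Choice) (ℓ : Loc)
  | allowChoice (ℓ : Loc) (d : Choice)
  | syncTau
  | func (l : Label Loc Expr)
  | arg (l : Label Loc Expr)

/-- `CtrlStep l E₁ E₂`: the control program `E₁` steps to `E₂` with label `l`. -/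
inductive CtrlStep {Loc : Type u} {Expr : Type v} [LocalLanguage Expr] :
    Label Loc Expr → Ctrl Loc Expr → Ctrl Loc Expr → Prop
  | retE {e₁ e₂ : Expr} :
      LocalLanguage.Step e₁ e₂ → CtrlStep .tau (.ret e₁) (.ret e₂)
  | ifE {e₁ e₂ : Expr} {E₁ E₂ : Ctrl Loc Expr} :
      LocalLanguage.Step e₁ e₂ → CtrlStep .tau (.ite e₁ E₁ E₂) (.ite e₂ E₁ E₂)
  | ifTrue {E₁ E₂ : Ctrl Loc Expr} : CtrlStep .tau (.ite LocalLanguage.tt E₁ E₂) E₁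
  | ifFalse {E₁ E₂ : Ctrl Loc Expr} : CtrlStep .tau (.ite LocalLanguage.ff E₁ E₂) E₂
  | sendE {e₁ e₂ : Expr} {ℓ : Loc} {E : Ctrl Loc Expr} :
      LocalLanguage.Step e₁ e₂ → CtrlStep .tau (.send e₁ ℓ E) (.send e₂ ℓ E)
  | sendV {v : Expr} {ℓ : Loc} {E : Ctrl Loc Expr} :
      LocalLanguage.Value v → CtrlStep (.send v ℓ) (.send v ℓ E) E
  | recvV {v : Expr} {ℓ : Loc} {E : Ctrl Loc Expr} :
      LocalLanguage.Value v → CtrlStep (.recv ℓ v) (.recv ℓ E) (E.lsubst (singleSubst v))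
  | choose {d : Choice} {ℓ : Loc} {E : Ctrl Loc Expr} :
      CtrlStep (.choose d ℓ) (.choose d ℓ E) E
  | allowL {ℓ : Loc} {E : Ctrl Loc Expr} :
      CtrlStep (.allowChoice ℓ .left) (.allowL ℓ E) E
  | allowR {ℓ : Loc} {E : Ctrl Loc Expr} :
      CtrlStep (.allowChoice ℓ .right) (.allowR ℓ E) E
  | allowLRLeft {ℓ : Loc} {E₁ E₂ : Ctrl Loc Expr} :
      CtrlStep (.allowChoice ℓ .left) (.allowLR ℓ E₁ E₂) E₁
  | allowLRRight {ℓ : Loc} {E₁ E₂ : Ctrl Loc Expr} :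
      CtrlStep (.allowChoice ℓ .right) (.allowLR ℓ E₁ E₂) E₂
  | letRetArg {l : Label Loc Expr} {E₁ E₁' E₂ : Ctrl Loc Expr} :
      CtrlStep l E₁ E₁' → CtrlStep (.arg l) (.letRet E₁ E₂) (.letRet E₁' E₂)
  | letRet {v : Expr} {E : Ctrl Loc Expr} :
      LocalLanguage.Value v →
      CtrlStep .syncTau (.letRet (.ret v) E) (E.lsubst (singleSubst v))
  | appLocalFun {l : Label Loc Expr} {E₁ E₂ : Ctrl Loc Expr} {e : Expr} :
      CtrlStep l E₁ E₂ → CtrlStep (.func l) (.appLocal E₁ e) (.appLocal E₂ e)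
  | appLocalArg {E : Ctrl Loc Expr} {e₁ e₂ : Expr} :
      LocalLanguage.Step e₁ e₂ → CtrlStep .tau (.appLocal E e₁) (.appLocal E e₂)
  | appLocal {v : Expr} {E : Ctrl Loc Expr} :
      LocalLanguage.Value v →
      CtrlStep .syncTau (.appLocal (.funLocal E) v)
        ((E.lsubst (singleSubst v)).gsubst (Ctrl.single (.funLocal E)))
  | appGlobalFun {l : Label Loc Expr} {E₁ E₁' E₂ : Ctrl Loc Expr} :
      CtrlStep l E₁ E₁' → CtrlStep (.func l) (.appGlobal E₁ E₂) (.appGlobal E₁' E₂)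
  | appGlobalArg {l : Label Loc Expr} {E₁ E₂ E₂' : Ctrl Loc Expr} :
      CtrlStep l E₂ E₂' → CtrlStep (.arg l) (.appGlobal E₁ E₂) (.appGlobal E₁ E₂')
  | appGlobal {E V : Ctrl Loc Expr} :
      V.Value →
      CtrlStep .syncTau (.appGlobal (.funGlobal E) V) (E.gsubst (Ctrl.double V (.funGlobal E)))

/-! ### Merging, endpoint projection and less nondeterminism -/

section Projection

variable {Loc : Type u} {Expr : Type v} [DecidableEq Loc] [DecidableEq Expr]

/-- The partial merge operator on control programs; `none` means undefined. -/
def Ctrl.merge : Ctrl Loc Expr → Ctrl Loc Expr → Option (Ctrl Loc Expr)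
  | .var m, .var n => if m = n then some (.var m) else none
  | .unit, .unit => some .unit
  | .ret e, .ret e' => if e = e' then some (.ret e) else none
  | .ite e E₁ E₂, .ite e' E₁' E₂' =>
      if e = e' then do
        let F₁ ← Ctrl.merge E₁ E₁'
        let F₂ ← Ctrl.merge E₂ E₂'
        some (.ite e F₁ F₂)
      else none
  | .send e ℓ E, .send e' ℓ' E' =>
      if e = e' ∧ ℓ = ℓ' then (Ctrl.merge E E').map (.send e ℓ) else none
  | .recv ℓ E, .recv ℓ' E' => if ℓ = ℓ' then (Ctrl.merge E E').map (.recv ℓ) else none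
  | .choose d ℓ E, .choose d' ℓ' E' =>
      if d = d' ∧ ℓ = ℓ' then (Ctrl.merge E E').map (.choose d ℓ) else none
  | .allowL ℓ E, .allowL ℓ' E' => if ℓ = ℓ' then (Ctrl.merge E E').map (.allowL ℓ) else none
  | .allowL ℓ E, .allowR ℓ' E' => if ℓ = ℓ' then some (.allowLR ℓ E E') else none
  | .allowL ℓ E, .allowLR ℓ' E₁' E₂' =>
      if ℓ = ℓ' then (Ctrl.merge E E₁').map (fun F => .allowLR ℓ F E₂') else none
  | .allowR ℓ E, .allowL ℓ' E' => if ℓ = ℓ' then some (.allowLR ℓ E' E) else none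
  | .allowR ℓ E, .allowR ℓ' E' => if ℓ = ℓ' then (Ctrl.merge E E').map (.allowR ℓ) else none
  | .allowR ℓ E, .allowLR ℓ' E₁' E₂' =>
      if ℓ = ℓ' then (Ctrl.merge E E₂').map (fun F => .allowLR ℓ E₁' F) else none
  | .allowLR ℓ E₁ E₂, .allowL ℓ' E' =>
      if ℓ = ℓ' then (Ctrl.merge E₁ E').map (fun F => .allowLR ℓ F E₂) else none
  | .allowLR ℓ E₁ E₂, .allowR ℓ' E' =>
      if ℓ = ℓ' then (Ctrl.merge E₂ E').map (fun F => .allowLR ℓ E₁ F) else none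
  | .allowLR ℓ E₁ E₂, .allowLR ℓ' E₁' E₂' =>
      if ℓ = ℓ' then do
        let F₁ ← Ctrl.merge E₁ E₁'
        let F₂ ← Ctrl.merge E₂ E₂'
        some (.allowLR ℓ F₁ F₂)
      else none
  | .letRet E₁ E₂, .letRet E₁' E₂' => do
      let F₁ ← Ctrl.merge E₁ E₁'
      let F₂ ← Ctrl.merge E₂ E₂'
      some (.letRet F₁ F₂)
  | .funLocal E, .funLocal E' => if E = E' then some (.funLocal E) else none
  | .funGlobal E, .funGlobal E' => if E = E' then some (.funGlobal E) else none
  | .appLocal E e, .appLocal E' e' =>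
      if e = e' then (Ctrl.merge E E').map (fun F => .appLocal F e) else none
  | .appGlobal E₁ E₂, .appGlobal E₁' E₂' => do
      let F₁ ← Ctrl.merge E₁ E₁'
      let F₂ ← Ctrl.merge E₂ E₂'
      some (.appGlobal F₁ F₂)
  | _, _ => none

/-- Endpoint projection `C.proj ℓ` of the choreography `C` to the location `ℓ`; `none` means
undefined.  Renaming control variables by `(· + k)` makes the `k` innermost bound variables
fresh. -/
def Chor.proj : Chor Loc Expr → Loc → Option (Ctrl Loc Expr)
  | .var n, _ => some (.var n)
  | .done ℓ₁ e, ℓ => if ℓ₁ = ℓ then some (.ret e) else some .unit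
  | .send ℓ₁ e ℓ₂ C, ℓ =>
      if ℓ₁ = ℓ then
        if ℓ₂ = ℓ then none else (C.proj ℓ).map (.send e ℓ₂)
      else if ℓ₂ = ℓ then (C.proj ℓ).map (.recv ℓ₁)
      else C.proj ℓ
  | .ite ℓ₁ e C₁ C₂, ℓ => do
      let E₁ ← C₁.proj ℓ
      let E₂ ← C₂.proj ℓ
      if ℓ₁ = ℓ then some (.ite e E₁ E₂) else Ctrl.merge E₁ E₂
  | .sync ℓ₁ d ℓ₂ C, ℓ =>
      if ℓ₁ = ℓ then
        if ℓ₂ = ℓ then none else (C.proj ℓ).map (.choose d ℓ₂)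
      else if ℓ₂ = ℓ then
        match d with
        | .left => (C.proj ℓ).map (.allowL ℓ₁)
        | .right => (C.proj ℓ).map (.allowR ℓ₁)
      else C.proj ℓ
  | .defLocal ℓ₁ C₁ C₂, ℓ => do
      let E₁ ← C₁.proj ℓ
      let E₂ ← C₂.proj ℓ
      if ℓ₁ = ℓ then some (.letRet E₁ E₂)
      else some (.appGlobal (.funGlobal (E₂.gren (· + 2))) E₁)
  | .funLocal ℓ₁ C, ℓ =>
      if ℓ₁ = ℓ then (C.proj ℓ).map .funLocal
      else (C.proj ℓ).map (fun E => .funGlobal (E.gren (· + 1)))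
  | .funGlobal C, ℓ => (C.proj ℓ).map .funGlobal
  | .appLocal ℓ₁ C e, ℓ =>
      if ℓ₁ = ℓ then (C.proj ℓ).map (fun E => .appLocal E e)
      else (C.proj ℓ).map (fun E => .appGlobal E .unit)
  | .appGlobal C₁ C₂, ℓ => do
      let E₁ ← C₁.proj ℓ
      let E₂ ← C₂.proj ℓ
      some (.appGlobal E₁ E₂)

/-- Projection of a redex to a control-program label, from the point of view of one location;
`none` means undefined. -/
def Redex.proj : Redex Loc Expr → Loc → Option (Label Loc Expr)
  | .done ℓ₁ _ _, ℓ => if ℓ₁ = ℓ then some .tau else none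
  | .ifE ℓ₁ _ _, ℓ => if ℓ₁ = ℓ then some .tau else none
  | .ifT ℓ₁, ℓ => if ℓ₁ = ℓ then some .tau else none
  | .ifF ℓ₁, ℓ => if ℓ₁ = ℓ then some .tau else none
  | .sendE ℓ₁ _ _ _, ℓ => if ℓ₁ = ℓ then some .tau else none
  | .sendV ℓ₁ v ℓ₂, ℓ =>
      if ℓ₁ = ℓ ∧ ℓ₂ ≠ ℓ then some (.send v ℓ₂)
      else if ℓ₁ ≠ ℓ ∧ ℓ₂ = ℓ then some (.recv ℓ₁ v)
      else none
  | .sync ℓ₁ d ℓ₂, ℓ =>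
      if ℓ₁ = ℓ ∧ ℓ₂ ≠ ℓ then some (.choose d ℓ₂)
      else if ℓ₁ ≠ ℓ ∧ ℓ₂ = ℓ then some (.allowChoice ℓ₁ d)
      else none
  | .defLocal _ _, _ => some .syncTau
  | .appLocalE ℓ₁ _ _, ℓ => if ℓ₁ = ℓ then some .tau else none
  | .appLocal _ _, _ => some .syncTau
  | .appGlobal, _ => some .syncTau
  | .arg R, ℓ => (R.proj ℓ).map .arg
  | .func R, ℓ => (R.proj ℓ).map .func

end Projection

/-- `LessNondet E₁ E₂`: the control program `E₁` is less nondeterministic than `E₂`, that is, `E₁`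
is `E₂` with some external choices possibly resolved. -/
inductive LessNondet {Loc : Type u} {Expr : Type v} : Ctrl Loc Expr → Ctrl Loc Expr → Prop
  | var (n : ℕ) : LessNondet (.var n) (.var n)
  | unit : LessNondet .unit .unit
  | ret (e : Expr) : LessNondet (.ret e) (.ret e)
  | ite {e : Expr} {E₁ E₁' E₂ E₂' : Ctrl Loc Expr} :
      LessNondet E₁ E₁' → LessNondet E₂ E₂' → LessNondet (.ite e E₁ E₂) (.ite e E₁' E₂')
  | send {e : Expr} {ℓ : Loc} {E E' : Ctrl Loc Expr} :
      LessNondet E E' → LessNondet (.send e ℓ E) (.send e ℓ E')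
  | recv {ℓ : Loc} {E E' : Ctrl Loc Expr} :
      LessNondet E E' → LessNondet (.recv ℓ E) (.recv ℓ E')
  | choose {d : Choice} {ℓ : Loc} {E E' : Ctrl Loc Expr} :
      LessNondet E E' → LessNondet (.choose d ℓ E) (.choose d ℓ E')
  | allowL {ℓ : Loc} {E E' : Ctrl Loc Expr} :
      LessNondet E E' → LessNondet (.allowL ℓ E) (.allowL ℓ E')
  | allowLLR {ℓ : Loc} {E E₁' E₂' : Ctrl Loc Expr} :
      LessNondet E E₁' → LessNondet (.allowL ℓ E) (.allowLR ℓ E₁' E₂')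
  | allowR {ℓ : Loc} {E E' : Ctrl Loc Expr} :
      LessNondet E E' → LessNondet (.allowR ℓ E) (.allowR ℓ E')
  | allowRLR {ℓ : Loc} {E E₁' E₂' : Ctrl Loc Expr} :
      LessNondet E E₂' → LessNondet (.allowR ℓ E) (.allowLR ℓ E₁' E₂')
  | allowLR {ℓ : Loc} {E₁ E₁' E₂ E₂' : Ctrl Loc Expr} :
      LessNondet E₁ E₁' → LessNondet E₂ E₂' →
      LessNondet (.allowLR ℓ E₁ E₂) (.allowLR ℓ E₁' E₂')
  | letRet {E₁ E₁' E₂ E₂' : Ctrl Loc Expr} :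
      LessNondet E₁ E₁' → LessNondet E₂ E₂' → LessNondet (.letRet E₁ E₂) (.letRet E₁' E₂')
  | funLocal (E : Ctrl Loc Expr) : LessNondet (.funLocal E) (.funLocal E)
  | funGlobal (E : Ctrl Loc Expr) : LessNondet (.funGlobal E) (.funGlobal E)
  | appLocal {E E' : Ctrl Loc Expr} {e : Expr} :
      LessNondet E E' → LessNondet (.appLocal E e) (.appLocal E' e)
  | appGlobal {E₁ E₁' E₂ E₂' : Ctrl Loc Expr} :
      LessNondet E₁ E₁' → LessNondet E₂ E₂' →
      LessNondet (.appGlobal E₁ E₂) (.appGlobal E₁' E₂')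

end Pirouette

namespace Pirouette

universe u v

variable {Loc : Type u} {Expr : Type v}

/-! ### Merging as a relation -/

/-! The proof is an induction on the choreography step. Projection and merging are replaced by their
graphs, `Projects` and `Merges`, so that each hypothesis can be inverted. The passage back to the
partial functions happens only in the final theorem.

The hard case is an out-of-order step inside both branches of an `if` decided elsewhere, where the
location runs the merge of the two branch projections. If it takes part in the redex, both
projections step and the merge must step to a merge of the results. A label alone is too weak for
this: two local steps labelled `tau` may lead to different expressions. Hence the induction carries
`RedexStep`, which remembers the redex, and `RedexStep.merges` settles the case. Global
synchronizations do not arise there, since the deciding location is blocked and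
`ChorStep.proj_eq_none` says that a blocked location has no part in the redex.

If the location takes no part, each branch projection becomes less nondeterministic, so both results
lie below the old merge. Merging is the join of any two programs with a common upper bound
(`Merges.left_le`, `LessNondet.exists_merges`), so the new merge exists and still lies below the old
one.

For communications, a location that is an endpoint of a skipped one is blocked, and congruence of
the order suffices. For the reductions with substitution, projection commutes with substitution
(`Projects.lsubst`, `Projects.gsubst`) and preserves values (`Projects.value`). A location that does
not own a local binder sees dummy control binders instead; substituting for those cancels the shift
that projection inserted. -/

/-- The graph of `Ctrl.merge`. -/
inductive Merges : Ctrl Loc Expr → Ctrl Loc Expr → Ctrl Loc Expr → Prop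
  | var (n : ℕ) : Merges (.var n) (.var n) (.var n)
  | unit : Merges .unit .unit .unit
  | ret (e : Expr) : Merges (.ret e) (.ret e) (.ret e)
  | ite {e : Expr} {E₁ E₂ E₁' E₂' F₁ F₂ : Ctrl Loc Expr} :
      Merges E₁ E₁' F₁ → Merges E₂ E₂' F₂ →
      Merges (.ite e E₁ E₂) (.ite e E₁' E₂') (.ite e F₁ F₂)
  | send {e : Expr} {ℓ : Loc} {E E' F : Ctrl Loc Expr} :
      Merges E E' F → Merges (.send e ℓ E) (.send e ℓ E') (.send e ℓ F)
  | recv {ℓ : Loc} {E E' F : Ctrl Loc Expr} :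
      Merges E E' F → Merges (.recv ℓ E) (.recv ℓ E') (.recv ℓ F)
  | choose {d : Choice} {ℓ : Loc} {E E' F : Ctrl Loc Expr} :
      Merges E E' F → Merges (.choose d ℓ E) (.choose d ℓ E') (.choose d ℓ F)
  | allowLL {ℓ : Loc} {E E' F : Ctrl Loc Expr} :
      Merges E E' F → Merges (.allowL ℓ E) (.allowL ℓ E') (.allowL ℓ F)
  | allowRR {ℓ : Loc} {E E' F : Ctrl Loc Expr} :
      Merges E E' F → Merges (.allowR ℓ E) (.allowR ℓ E') (.allowR ℓ F)
  | allowLR (ℓ : Loc) (E E' : Ctrl Loc Expr) :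
      Merges (.allowL ℓ E) (.allowR ℓ E') (.allowLR ℓ E E')
  | allowRL (ℓ : Loc) (E E' : Ctrl Loc Expr) :
      Merges (.allowR ℓ E') (.allowL ℓ E) (.allowLR ℓ E E')
  | allowLB {ℓ : Loc} {E E' F G : Ctrl Loc Expr} :
      Merges E E' F → Merges (.allowL ℓ E) (.allowLR ℓ E' G) (.allowLR ℓ F G)
  | allowBL {ℓ : Loc} {E E' F G : Ctrl Loc Expr} :
      Merges E E' F → Merges (.allowLR ℓ E G) (.allowL ℓ E') (.allowLR ℓ F G)
  | allowRB {ℓ : Loc} {E E' F G : Ctrl Loc Expr} :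
      Merges E E' F → Merges (.allowR ℓ E) (.allowLR ℓ G E') (.allowLR ℓ G F)
  | allowBR {ℓ : Loc} {E E' F G : Ctrl Loc Expr} :
      Merges E E' F → Merges (.allowLR ℓ G E) (.allowR ℓ E') (.allowLR ℓ G F)
  | allowBB {ℓ : Loc} {E₁ E₂ E₁' E₂' F₁ F₂ : Ctrl Loc Expr} :
      Merges E₁ E₁' F₁ → Merges E₂ E₂' F₂ →
      Merges (.allowLR ℓ E₁ E₂) (.allowLR ℓ E₁' E₂') (.allowLR ℓ F₁ F₂)
  | letRet {E₁ E₂ E₁' E₂' F₁ F₂ : Ctrl Loc Expr} :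
      Merges E₁ E₁' F₁ → Merges E₂ E₂' F₂ →
      Merges (.letRet E₁ E₂) (.letRet E₁' E₂') (.letRet F₁ F₂)
  | funLocal (E : Ctrl Loc Expr) : Merges (.funLocal E) (.funLocal E) (.funLocal E)
  | funGlobal (E : Ctrl Loc Expr) : Merges (.funGlobal E) (.funGlobal E) (.funGlobal E)
  | appLocal {E E' F : Ctrl Loc Expr} {e : Expr} :
      Merges E E' F → Merges (.appLocal E e) (.appLocal E' e) (.appLocal F e)
  | appGlobal {E₁ E₂ E₁' E₂' F₁ F₂ : Ctrl Loc Expr} :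
      Merges E₁ E₁' F₁ → Merges E₂ E₂' F₂ →
      Merges (.appGlobal E₁ E₂) (.appGlobal E₁' E₂') (.appGlobal F₁ F₂)

theorem Merges.merge_eq [DecidableEq Loc] [DecidableEq Expr] {E₁ E₂ E : Ctrl Loc Expr}
    (h : Merges E₁ E₂ E) : Ctrl.merge E₁ E₂ = some E := by
  induction h <;> simp_all [Ctrl.merge]

theorem merges_of_merge_eq [DecidableEq Loc] [DecidableEq Expr] (E₁ E₂ : Ctrl Loc Expr) :
    ∀ E, Ctrl.merge E₁ E₂ = some E → Merges E₁ E₂ E := by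
  fun_induction Ctrl.merge E₁ E₂ <;> intro E h
  all_goals
    simp only [Option.bind_eq_bind, Option.bind_eq_some_iff, Option.map_eq_some_iff,
      Option.some.injEq, reduceCtorEq] at h
  all_goals
    -- The pattern is written for two recursive merges; with one or none, the equation for `E` comes
    -- earlier in `h`.
    obtain ⟨F₁, h₁, F₂, h₂, rfl⟩ := h
    try obtain ⟨rfl, rfl⟩ := ‹_ ∧ _›
    constructor <;> apply_assumption <;> assumption

theorem Merges.refl (E : Ctrl Loc Expr) : Merges E E E := by
  induction E <;> constructor <;> assumption

theorem Merges.symm {E₁ E₂ E : Ctrl Loc Expr} (h : Merges E₁ E₂ E) : Merges E₂ E₁ E := by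
  induction h <;> constructor <;> assumption

/-! ### Less nondeterminism as an order, with merging as bounded join -/

theorem LessNondet.refl (E : Ctrl Loc Expr) : LessNondet E E := by
  induction E <;> constructor <;> assumption

theorem LessNondet.trans {E₁ E₂ E₃ : Ctrl Loc Expr} (h : LessNondet E₁ E₂)
    (h' : LessNondet E₂ E₃) : LessNondet E₁ E₃ := by
  induction h generalizing E₃ <;> cases h' <;> constructor <;> apply_assumption <;> assumption

/-- Merging can only add missing branches to an `allow`. This is the upper-bound half of the join
property, and it gives the order for a branch discarded by a conditional. -/
theorem Merges.left_le {E₁ E₂ E : Ctrl Loc Expr} (h : Merges E₁ E₂ E) : LessNondet E₁ E := by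
  induction h <;> constructor <;> first | assumption | exact LessNondet.refl _

theorem Merges.right_le {E₁ E₂ E : Ctrl Loc Expr} (h : Merges E₁ E₂ E) : LessNondet E₂ E :=
  h.symm.left_le

/-- Two programs below the same `E` agree with it except for the `allow` branches they have dropped,
so no conflict can prevent their merge, and the merge contains no branch that `E` lacks. Functions
pose no obstacle, because the order relates them only to themselves. This is what shows that
projection stays defined after an out-of-order step. -/
theorem LessNondet.exists_merges {E₁ E₂ E : Ctrl Loc Expr} (h₁ : LessNondet E₁ E)
    (h₂ : LessNondet E₂ E) : ∃ F, Merges E₁ E₂ F ∧ LessNondet F E := by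
  induction h₁ generalizing E₂ with
  | var n => cases h₂; exact ⟨_, .var n, .var n⟩
  | unit => cases h₂; exact ⟨_, .unit, .unit⟩
  | ret e => cases h₂; exact ⟨_, .ret e, .ret e⟩
  | funLocal E => cases h₂; exact ⟨_, .funLocal E, .funLocal E⟩
  | funGlobal E => cases h₂; exact ⟨_, .funGlobal E, .funGlobal E⟩
  | ite _ _ ih₁ ih₂ =>
    cases h₂ with
    | ite k₁ k₂ =>
      obtain ⟨F₁, m₁, l₁⟩ := ih₁ k₁
      obtain ⟨F₂, m₂, l₂⟩ := ih₂ k₂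
      exact ⟨_, .ite m₁ m₂, .ite l₁ l₂⟩
  | letRet _ _ ih₁ ih₂ =>
    cases h₂ with
    | letRet k₁ k₂ =>
      obtain ⟨F₁, m₁, l₁⟩ := ih₁ k₁
      obtain ⟨F₂, m₂, l₂⟩ := ih₂ k₂
      exact ⟨_, .letRet m₁ m₂, .letRet l₁ l₂⟩
  | appGlobal _ _ ih₁ ih₂ =>
    cases h₂ with
    | appGlobal k₁ k₂ =>
      obtain ⟨F₁, m₁, l₁⟩ := ih₁ k₁
      obtain ⟨F₂, m₂, l₂⟩ := ih₂ k₂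
      exact ⟨_, .appGlobal m₁ m₂, .appGlobal l₁ l₂⟩
  | send _ ih =>
    cases h₂ with
    | send k => obtain ⟨F, m, l⟩ := ih k; exact ⟨_, .send m, .send l⟩
  | recv _ ih =>
    cases h₂ with
    | recv k => obtain ⟨F, m, l⟩ := ih k; exact ⟨_, .recv m, .recv l⟩
  | choose _ ih =>
    cases h₂ with
    | choose k => obtain ⟨F, m, l⟩ := ih k; exact ⟨_, .choose m, .choose l⟩
  | appLocal _ ih =>
    cases h₂ with
    | appLocal k => obtain ⟨F, m, l⟩ := ih k; exact ⟨_, .appLocal m, .appLocal l⟩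
  | allowL _ ih =>
    cases h₂ with
    | allowL k => obtain ⟨F, m, l⟩ := ih k; exact ⟨_, .allowLL m, .allowL l⟩
  | allowR _ ih =>
    cases h₂ with
    | allowR k => obtain ⟨F, m, l⟩ := ih k; exact ⟨_, .allowRR m, .allowR l⟩
  | allowLLR h ih =>
    cases h₂ with
    | allowLLR k => obtain ⟨F, m, l⟩ := ih k; exact ⟨_, .allowLL m, .allowLLR l⟩
    -- The programs kept opposite branches, so nothing is merged recursively: the two branches are
    -- put side by side and are bounded by `h` and `k`.
    | allowRLR k => exact ⟨_, .allowLR _ _ _, .allowLR h k⟩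
    | allowLR k₁ k₂ => obtain ⟨F, m, l⟩ := ih k₁; exact ⟨_, .allowLB m, .allowLR l k₂⟩
  | allowRLR h ih =>
    cases h₂ with
    | allowLLR k => exact ⟨_, .allowRL _ _ _, .allowLR k h⟩
    | allowRLR k => obtain ⟨F, m, l⟩ := ih k; exact ⟨_, .allowRR m, .allowRLR l⟩
    | allowLR k₁ k₂ => obtain ⟨F, m, l⟩ := ih k₂; exact ⟨_, .allowRB m, .allowLR k₁ l⟩
  | allowLR h₁ h₂' ih₁ ih₂ =>
    cases h₂ with
    | allowLLR k => obtain ⟨F, m, l⟩ := ih₁ k; exact ⟨_, .allowBL m, .allowLR l h₂'⟩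
    | allowRLR k => obtain ⟨F, m, l⟩ := ih₂ k; exact ⟨_, .allowBR m, .allowLR h₁ l⟩
    | allowLR k₁ k₂ =>
      obtain ⟨F₁, m₁, l₁⟩ := ih₁ k₁
      obtain ⟨F₂, m₂, l₂⟩ := ih₂ k₂
      exact ⟨_, .allowBB m₁ m₂, .allowLR l₁ l₂⟩

/-! ### Substitution in control programs -/

theorem upRen_id : upRen id = id := by
  funext n; cases n <;> rfl

theorem upRen_comp (ξ ζ : ℕ → ℕ) : upRen ζ ∘ upRen ξ = upRen (ζ ∘ ξ) := by
  funext n; cases n <;> rfl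

theorem upSubst_var [LocalLanguage Expr] :
    upSubst (LocalLanguage.var : ℕ → Expr) = LocalLanguage.var := by
  funext n
  cases n
  · rfl
  · simp [upSubst, LocalLanguage.ren_eq_subst, LocalLanguage.subst_var]

theorem ren_id [LocalLanguage Expr] (e : Expr) : LocalLanguage.ren e id = e := by
  rw [LocalLanguage.ren_eq_subst]
  exact LocalLanguage.subst_id e

namespace Ctrl

theorem gren_gren (E : Ctrl Loc Expr) (ξ ζ : ℕ → ℕ) :
    (E.gren ξ).gren ζ = E.gren (ζ ∘ ξ) := by
  induction E generalizing ξ ζ <;> simp_all [gren, upRen_comp]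

theorem upG_var : upG (var : ℕ → Ctrl Loc Expr) = var := by
  funext n; cases n <;> rfl

theorem upG_gren (σ : ℕ → Ctrl Loc Expr) (ξ : ℕ → ℕ) :
    upG (fun n => (σ n).gren ξ) = fun n => (upG σ n).gren (upRen ξ) := by
  funext n
  cases n
  · rfl
  · simp only [upG, gren_gren]; rfl

theorem upG_comp_upRen (σ : ℕ → Ctrl Loc Expr) (ξ : ℕ → ℕ) :
    upG σ ∘ upRen ξ = upG (σ ∘ ξ) := by
  funext n; cases n <;> rfl

variable [LocalLanguage Expr]

theorem lren_id (E : Ctrl Loc Expr) : E.lren id = E := by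
  induction E <;> simp_all [lren, ren_id, upRen_id]

theorem lsubst_var (E : Ctrl Loc Expr) : E.lsubst LocalLanguage.var = E := by
  induction E <;> simp_all [lsubst, LocalLanguage.subst_id, upSubst_var]

theorem gren_lren (E : Ctrl Loc Expr) (ξ ζ : ℕ → ℕ) :
    (E.gren ξ).lren ζ = (E.lren ζ).gren ξ := by
  induction E generalizing ξ ζ <;> simp_all [lren, gren]

theorem gren_lsubst (E : Ctrl Loc Expr) (ξ : ℕ → ℕ) (σ : ℕ → Expr) :
    (E.gren ξ).lsubst σ = (E.lsubst σ).gren ξ := by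
  induction E generalizing ξ σ <;> simp_all [lsubst, gren]

theorem upGLoc_var : upGLoc (var : ℕ → Ctrl Loc Expr) = var := rfl

theorem gsubst_var (E : Ctrl Loc Expr) : E.gsubst var = E := by
  induction E <;> simp_all [gsubst, upG_var, upGLoc_var]

theorem upGLoc_comp (σ : ℕ → Ctrl Loc Expr) (ξ : ℕ → ℕ) :
    upGLoc σ ∘ ξ = upGLoc (σ ∘ ξ) := rfl

theorem gren_gsubst (E : Ctrl Loc Expr) (ξ : ℕ → ℕ) (σ : ℕ → Ctrl Loc Expr) :
    (E.gren ξ).gsubst σ = E.gsubst (σ ∘ ξ) := by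
  induction E generalizing ξ σ <;> simp_all [gren, gsubst, upG_comp_upRen, upGLoc_comp]

theorem upGLoc_gren (σ : ℕ → Ctrl Loc Expr) (ξ : ℕ → ℕ) :
    upGLoc (fun n => (σ n).gren ξ) = fun n => (upGLoc σ n).gren ξ := by
  funext n
  simp only [upGLoc, gren_lren]

theorem gsubst_gren (E : Ctrl Loc Expr) (σ : ℕ → Ctrl Loc Expr) (ξ : ℕ → ℕ) :
    (E.gsubst σ).gren ξ = E.gsubst (fun n => (σ n).gren ξ) := by
  induction E generalizing ξ σ <;> simp_all [gren, gsubst, upG_gren, upGLoc_gren]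

/-- The shift by one is the dummy argument that a local function acquires at a location not owning
it. A substitution passing that extra binder must be lifted once more. -/
theorem gsubst_upG_gren (E : Ctrl Loc Expr) (σ : ℕ → Ctrl Loc Expr) :
    (E.gsubst σ).gren (· + 1) = (E.gren (· + 1)).gsubst (upG σ) := by
  rw [gsubst_gren, gren_gsubst]; rfl

/-- The counterpart for a `let` owned elsewhere, whose projection adds two control binders, the
dummy function name and the dummy argument, where the choreography has none. -/
theorem gsubst_upG_upG_gren (E : Ctrl Loc Expr) (σ : ℕ → Ctrl Loc Expr) :
    (E.gsubst σ).gren (· + 2) = (E.gren (· + 2)).gsubst (upG (upG σ)) := by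
  rw [gsubst_gren, gren_gsubst]
  congr 1
  funext n
  simp only [Function.comp, upG, gren_gren]
  rfl

theorem gren_closedBelow {E : Ctrl Loc Expr} {n m m' : ℕ} {ξ : ℕ → ℕ}
    (h : E.ClosedBelow n m) (hξ : ∀ k, k < m → ξ k < m') : (E.gren ξ).ClosedBelow n m' := by
  have up : ∀ {m m' : ℕ} {ξ : ℕ → ℕ}, (∀ k, k < m → ξ k < m') →
      ∀ k, k < m + 1 → upRen ξ k < m' + 1 := by
    intro m m' ξ hξ k hk
    cases k with
    | zero => exact Nat.succ_pos _
    | succ k => exact Nat.succ_lt_succ (hξ k (Nat.lt_of_succ_lt_succ hk))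
  induction E generalizing n m m' ξ with
  | funLocal E ih => exact ih (m' := m' + 1) h (up hξ)
  | funGlobal E ih => exact ih (m' := m' + 2) h (up (up hξ))
  | _ => simp_all only [gren, ClosedBelow] <;> grind

end Ctrl

/-! ### Merging is stable under renaming, substitution and bounds on free variables -/

section MergeSubst

theorem Merges.gren {E₁ E₂ E : Ctrl Loc Expr} (h : Merges E₁ E₂ E) (ξ : ℕ → ℕ) :
    Merges (E₁.gren ξ) (E₂.gren ξ) (E.gren ξ) := by
  induction h generalizing ξ <;> constructor <;> apply_assumption

variable [LocalLanguage Expr]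

theorem Merges.lren {E₁ E₂ E : Ctrl Loc Expr} (h : Merges E₁ E₂ E) (ξ : ℕ → ℕ) :
    Merges (E₁.lren ξ) (E₂.lren ξ) (E.lren ξ) := by
  induction h generalizing ξ <;> constructor <;> apply_assumption

theorem Merges.lsubst {E₁ E₂ E : Ctrl Loc Expr} (h : Merges E₁ E₂ E) (σ : ℕ → Expr) :
    Merges (E₁.lsubst σ) (E₂.lsubst σ) (E.lsubst σ) := by
  induction h generalizing σ <;> constructor <;> apply_assumption

theorem Merges.gsubst {E₁ E₂ E : Ctrl Loc Expr} (h : Merges E₁ E₂ E)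
    (σ : ℕ → Ctrl Loc Expr) : Merges (E₁.gsubst σ) (E₂.gsubst σ) (E.gsubst σ) := by
  induction h generalizing σ with
  -- The same program is substituted on both sides, so idempotence of merging is what is needed.
  | var n => exact Merges.refl _
  | _ => constructor <;> apply_assumption

theorem Merges.closedBelow {E₁ E₂ E : Ctrl Loc Expr} (h : Merges E₁ E₂ E) {n m : ℕ}
    (h₁ : E₁.ClosedBelow n m) (h₂ : E₂.ClosedBelow n m) : E.ClosedBelow n m := by
  induction h generalizing n m <;> simp_all [Ctrl.ClosedBelow]

end MergeSubst

/-! ### Steps annotated with the redex -/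

/-- `RedexStep ℓ R E E'`: the control program `E` of `ℓ` performs its part of the redex `R`.
Unlike a label, the redex determines the result of a step of a local expression. -/
inductive RedexStep [LocalLanguage Expr] (ℓ : Loc) :
    Redex Loc Expr → Ctrl Loc Expr → Ctrl Loc Expr → Prop
  | done {e₁ e₂ : Expr} :
      LocalLanguage.Step e₁ e₂ → RedexStep ℓ (.done ℓ e₁ e₂) (.ret e₁) (.ret e₂)
  | ifE {e₁ e₂ : Expr} {E₁ E₂ : Ctrl Loc Expr} :
      LocalLanguage.Step e₁ e₂ → RedexStep ℓ (.ifE ℓ e₁ e₂) (.ite e₁ E₁ E₂) (.ite e₂ E₁ E₂)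
  | ifT {E₁ E₂ : Ctrl Loc Expr} : RedexStep ℓ (.ifT ℓ) (.ite LocalLanguage.tt E₁ E₂) E₁
  | ifF {E₁ E₂ : Ctrl Loc Expr} : RedexStep ℓ (.ifF ℓ) (.ite LocalLanguage.ff E₁ E₂) E₂
  | sendE {e₁ e₂ : Expr} {ℓ₂ : Loc} {E : Ctrl Loc Expr} :
      LocalLanguage.Step e₁ e₂ →
      RedexStep ℓ (.sendE ℓ e₁ e₂ ℓ₂) (.send e₁ ℓ₂ E) (.send e₂ ℓ₂ E)
  | sendV {v : Expr} {ℓ₂ : Loc} {E : Ctrl Loc Expr} :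
      LocalLanguage.Value v → ℓ₂ ≠ ℓ → RedexStep ℓ (.sendV ℓ v ℓ₂) (.send v ℓ₂ E) E
  | recvV {v : Expr} {ℓ₁ : Loc} {E : Ctrl Loc Expr} :
      LocalLanguage.Value v → ℓ₁ ≠ ℓ →
      RedexStep ℓ (.sendV ℓ₁ v ℓ) (.recv ℓ₁ E) (E.lsubst (singleSubst v))
  | choose {d : Choice} {ℓ₂ : Loc} {E : Ctrl Loc Expr} :
      ℓ₂ ≠ ℓ → RedexStep ℓ (.sync ℓ d ℓ₂) (.choose d ℓ₂ E) E
  | allowL {ℓ₁ : Loc} {E : Ctrl Loc Expr} :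
      ℓ₁ ≠ ℓ → RedexStep ℓ (.sync ℓ₁ .left ℓ) (.allowL ℓ₁ E) E
  | allowR {ℓ₁ : Loc} {E : Ctrl Loc Expr} :
      ℓ₁ ≠ ℓ → RedexStep ℓ (.sync ℓ₁ .right ℓ) (.allowR ℓ₁ E) E
  | allowLRLeft {ℓ₁ : Loc} {E₁ E₂ : Ctrl Loc Expr} :
      ℓ₁ ≠ ℓ → RedexStep ℓ (.sync ℓ₁ .left ℓ) (.allowLR ℓ₁ E₁ E₂) E₁
  | allowLRRight {ℓ₁ : Loc} {E₁ E₂ : Ctrl Loc Expr} :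
      ℓ₁ ≠ ℓ → RedexStep ℓ (.sync ℓ₁ .right ℓ) (.allowLR ℓ₁ E₁ E₂) E₂
  | letRetArg {R : Redex Loc Expr} {E₁ E₁' E₂ : Ctrl Loc Expr} :
      RedexStep ℓ R E₁ E₁' → RedexStep ℓ (.arg R) (.letRet E₁ E₂) (.letRet E₁' E₂)
  | appLocalFun {R : Redex Loc Expr} {E₁ E₂ : Ctrl Loc Expr} {e : Expr} :
      RedexStep ℓ R E₁ E₂ → RedexStep ℓ (.func R) (.appLocal E₁ e) (.appLocal E₂ e)
  | appLocalArg {E : Ctrl Loc Expr} {e₁ e₂ : Expr} :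
      LocalLanguage.Step e₁ e₂ →
      RedexStep ℓ (.appLocalE ℓ e₁ e₂) (.appLocal E e₁) (.appLocal E e₂)
  | appGlobalFun {R : Redex Loc Expr} {E₁ E₁' E₂ : Ctrl Loc Expr} :
      RedexStep ℓ R E₁ E₁' → RedexStep ℓ (.func R) (.appGlobal E₁ E₂) (.appGlobal E₁' E₂)
  | appGlobalArg {R : Redex Loc Expr} {E₁ E₂ E₂' : Ctrl Loc Expr} :
      RedexStep ℓ R E₂ E₂' → RedexStep ℓ (.arg R) (.appGlobal E₁ E₂) (.appGlobal E₁ E₂')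
  -- These last three redices involve every location, so they never occur while some location is
  -- blocked and never have to be merged. Any `syncTau` step may therefore be recorded, without
  -- tracking its shape.
  | defLocal {ℓ₁ : Loc} {v : Expr} {E E' : Ctrl Loc Expr} :
      CtrlStep .syncTau E E' → RedexStep ℓ (.defLocal ℓ₁ v) E E'
  | appLocal {ℓ₁ : Loc} {v : Expr} {E E' : Ctrl Loc Expr} :
      CtrlStep .syncTau E E' → RedexStep ℓ (.appLocal ℓ₁ v) E E'
  | appGlobal {E E' : Ctrl Loc Expr} :
      CtrlStep .syncTau E E' → RedexStep ℓ .appGlobal E E'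

/-- Forgetting the redex leaves an ordinary labelled step. The first conjunct also makes a
`RedexStep` incompatible with `R.proj ℓ = none`, which separates the two alternatives of the
theorem. -/
theorem RedexStep.exists_ctrlStep [DecidableEq Loc] [LocalLanguage Expr] {ℓ : Loc}
    {R : Redex Loc Expr} {E E' : Ctrl Loc Expr} (h : RedexStep ℓ R E E') :
    ∃ l, R.proj ℓ = some l ∧ CtrlStep l E E' := by
  induction h with
  | done h => exact ⟨.tau, by simp [Redex.proj], .retE h⟩
  | ifE h => exact ⟨.tau, by simp [Redex.proj], .ifE h⟩
  | ifT => exact ⟨.tau, by simp [Redex.proj], .ifTrue⟩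
  | ifF => exact ⟨.tau, by simp [Redex.proj], .ifFalse⟩
  | sendE h => exact ⟨.tau, by simp [Redex.proj], .sendE h⟩
  | sendV hv hne => exact ⟨_, by simp only [Redex.proj]; simp [hne], .sendV hv⟩
  | recvV hv hne => exact ⟨_, by simp only [Redex.proj]; simp [hne], .recvV hv⟩
  | choose hne => exact ⟨_, by simp only [Redex.proj]; simp [hne], .choose⟩
  | allowL hne => exact ⟨_, by simp only [Redex.proj]; simp [hne], .allowL⟩
  | allowR hne => exact ⟨_, by simp only [Redex.proj]; simp [hne], .allowR⟩
  | allowLRLeft hne => exact ⟨_, by simp only [Redex.proj]; simp [hne], .allowLRLeft⟩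
  | allowLRRight hne => exact ⟨_, by simp only [Redex.proj]; simp [hne], .allowLRRight⟩
  | appLocalArg h => exact ⟨.tau, by simp [Redex.proj], .appLocalArg h⟩
  | defLocal h => exact ⟨_, rfl, h⟩
  | appLocal h => exact ⟨_, rfl, h⟩
  | appGlobal h => exact ⟨_, rfl, h⟩
  | letRetArg _ ih =>
    obtain ⟨l, hl, h⟩ := ih
    exact ⟨.arg l, by simp [Redex.proj, hl], .letRetArg h⟩
  | appLocalFun _ ih =>
    obtain ⟨l, hl, h⟩ := ih
    exact ⟨.func l, by simp [Redex.proj, hl], .appLocalFun h⟩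
  | appGlobalFun _ ih =>
    obtain ⟨l, hl, h⟩ := ih
    exact ⟨.func l, by simp [Redex.proj, hl], .appGlobalFun h⟩
  | appGlobalArg _ ih =>
    obtain ⟨l, hl, h⟩ := ih
    exact ⟨.arg l, by simp [Redex.proj, hl], .appGlobalArg h⟩

/-- Two programs that perform the same redex can do so after merging.  The location `ℓ'` that does
not take part excludes the redices that synchronize all locations. -/
theorem RedexStep.merges [DecidableEq Loc] [LocalLanguage Expr] {ℓ ℓ' : Loc}
    {R : Redex Loc Expr} {E₁ E₁' E₂ E₂' E : Ctrl Loc Expr} (hR : R.proj ℓ' = none)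
    (h₁ : RedexStep ℓ R E₁ E₁') (h₂ : RedexStep ℓ R E₂ E₂') (hm : Merges E₁ E₂ E) :
    ∃ E', Merges E₁' E₂' E' ∧ RedexStep ℓ R E E' := by
  induction h₁ generalizing E₂ E₂' E with
  | defLocal _ => simp [Redex.proj] at hR
  | appLocal _ => simp [Redex.proj] at hR
  | appGlobal _ => simp [Redex.proj] at hR
  -- The redex names the resulting expression, so both programs reach the same one even if local
  -- evaluation is nondeterministic.
  | done h => cases hm; cases h₂; exact ⟨_, .ret _, .done h⟩
  | ifE h => cases hm with | ite m₁ m₂ => cases h₂; exact ⟨_, .ite m₁ m₂, .ifE h⟩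
  | ifT => cases hm with | ite m₁ m₂ => cases h₂; exact ⟨_, m₁, .ifT⟩
  | ifF => cases hm with | ite m₁ m₂ => cases h₂; exact ⟨_, m₂, .ifF⟩
  | sendE h => cases hm with | send m => cases h₂; exact ⟨_, .send m, .sendE h⟩
  | sendV hv hne => cases hm with | send m => cases h₂; exact ⟨_, m, .sendV hv hne⟩
  | recvV hv hne => cases hm with | recv m => cases h₂; exact ⟨_, m.lsubst _, .recvV hv hne⟩
  | choose hne => cases hm with | choose m => cases h₂; exact ⟨_, m, .choose hne⟩
  | allowL hne =>
    cases hm with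
    | allowLL m => cases h₂; exact ⟨_, m, .allowL hne⟩
    -- The second program offers only the right branch, so it cannot perform the same left choice.
    | allowLR => cases h₂
    | allowLB m => cases h₂; exact ⟨_, m, .allowLRLeft hne⟩
  | allowR hne =>
    cases hm with
    | allowRR m => cases h₂; exact ⟨_, m, .allowR hne⟩
    | allowRL => cases h₂
    | allowRB m => cases h₂; exact ⟨_, m, .allowLRRight hne⟩
  | allowLRLeft hne =>
    cases hm with
    | allowBL m => cases h₂; exact ⟨_, m, .allowLRLeft hne⟩
    | allowBR m => cases h₂
    | allowBB m₁ m₂ => cases h₂; exact ⟨_, m₁, .allowLRLeft hne⟩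
  | allowLRRight hne =>
    cases hm with
    | allowBL m => cases h₂
    | allowBR m => cases h₂; exact ⟨_, m, .allowLRRight hne⟩
    | allowBB m₁ m₂ => cases h₂; exact ⟨_, m₂, .allowLRRight hne⟩
  | appLocalArg h => cases hm with | appLocal m => cases h₂; exact ⟨_, .appLocal m, .appLocalArg h⟩
  | letRetArg _ ih =>
    cases hm with
    | letRet m₁ m₂ =>
      cases h₂ with
      | letRetArg k =>
        obtain ⟨F, m, s⟩ := ih (by simpa [Redex.proj] using hR) k m₁
        exact ⟨_, .letRet m m₂, .letRetArg s⟩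
  | appLocalFun _ ih =>
    cases hm with
    | appLocal m =>
      cases h₂ with
      | appLocalFun k =>
        obtain ⟨F, m, s⟩ := ih (by simpa [Redex.proj] using hR) k m
        exact ⟨_, .appLocal m, .appLocalFun s⟩
  | appGlobalFun _ ih =>
    cases hm with
    | appGlobal m₁ m₂ =>
      cases h₂ with
      | appGlobalFun k =>
        obtain ⟨F, m, s⟩ := ih (by simpa [Redex.proj] using hR) k m₁
        exact ⟨_, .appGlobal m m₂, .appGlobalFun s⟩
  | appGlobalArg _ ih =>
    cases hm with
    | appGlobal m₁ m₂ =>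
      cases h₂ with
      | appGlobalArg k =>
        obtain ⟨F, m, s⟩ := ih (by simpa [Redex.proj] using hR) k m₂
        exact ⟨_, .appGlobal m₁ m, .appGlobalArg s⟩

/-- Every rule with designated actors requires them to be unblocked, the globally synchronizing
rules require that nothing be blocked, and passing to a subterm never shrinks the blocked set. -/
theorem ChorStep.proj_eq_none [DecidableEq Loc] [LocalLanguage Expr] {R : Redex Loc Expr}
    {B : Set Loc} {C₁ C₂ : Chor Loc Expr} (h : ChorStep R B C₁ C₂) {ℓ : Loc} (hℓ : ℓ ∈ B) :
    R.proj ℓ = none := by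
  induction h with
  | defLocal | appLocal | appGlobal => exact absurd hℓ (Set.notMem_empty ℓ)
  | sendI _ ih | syncI _ ih => exact ih (.inl hℓ)
  | ifI _ _ ih _ => exact ih (.inl hℓ)
  | defLocalI _ ih | appLocalFun _ ih | appGlobalFun _ ih | appGlobalArg _ ih =>
    simp [Redex.proj, ih hℓ]
  | _ => grind [Redex.proj]

/-! ### Projection as a relation -/

/-- The graph of endpoint projection to `ℓ`. -/
inductive Projects (ℓ : Loc) : Chor Loc Expr → Ctrl Loc Expr → Prop
  | var (n : ℕ) : Projects ℓ (.var n) (.var n)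
  | done (e : Expr) : Projects ℓ (.done ℓ e) (.ret e)
  | doneOther {ℓ₁ : Loc} (e : Expr) : ℓ₁ ≠ ℓ → Projects ℓ (.done ℓ₁ e) .unit
  | send {e : Expr} {ℓ₂ : Loc} {C : Chor Loc Expr} {E : Ctrl Loc Expr} :
      ℓ₂ ≠ ℓ → Projects ℓ C E → Projects ℓ (.send ℓ e ℓ₂ C) (.send e ℓ₂ E)
  | recv {e : Expr} {ℓ₁ : Loc} {C : Chor Loc Expr} {E : Ctrl Loc Expr} :
      ℓ₁ ≠ ℓ → Projects ℓ C E → Projects ℓ (.send ℓ₁ e ℓ C) (.recv ℓ₁ E)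
  | sendOther {e : Expr} {ℓ₁ ℓ₂ : Loc} {C : Chor Loc Expr} {E : Ctrl Loc Expr} :
      ℓ₁ ≠ ℓ → ℓ₂ ≠ ℓ → Projects ℓ C E → Projects ℓ (.send ℓ₁ e ℓ₂ C) E
  | ite {e : Expr} {C₁ C₂ : Chor Loc Expr} {E₁ E₂ : Ctrl Loc Expr} :
      Projects ℓ C₁ E₁ → Projects ℓ C₂ E₂ → Projects ℓ (.ite ℓ e C₁ C₂) (.ite e E₁ E₂)
  | iteOther {ℓ₁ : Loc} {e : Expr} {C₁ C₂ : Chor Loc Expr} {E₁ E₂ E : Ctrl Loc Expr} :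
      ℓ₁ ≠ ℓ → Projects ℓ C₁ E₁ → Projects ℓ C₂ E₂ → Merges E₁ E₂ E →
      Projects ℓ (.ite ℓ₁ e C₁ C₂) E
  | choose {d : Choice} {ℓ₂ : Loc} {C : Chor Loc Expr} {E : Ctrl Loc Expr} :
      ℓ₂ ≠ ℓ → Projects ℓ C E → Projects ℓ (.sync ℓ d ℓ₂ C) (.choose d ℓ₂ E)
  | allowL {ℓ₁ : Loc} {C : Chor Loc Expr} {E : Ctrl Loc Expr} :
      ℓ₁ ≠ ℓ → Projects ℓ C E → Projects ℓ (.sync ℓ₁ .left ℓ C) (.allowL ℓ₁ E)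
  | allowR {ℓ₁ : Loc} {C : Chor Loc Expr} {E : Ctrl Loc Expr} :
      ℓ₁ ≠ ℓ → Projects ℓ C E → Projects ℓ (.sync ℓ₁ .right ℓ C) (.allowR ℓ₁ E)
  | syncOther {d : Choice} {ℓ₁ ℓ₂ : Loc} {C : Chor Loc Expr} {E : Ctrl Loc Expr} :
      ℓ₁ ≠ ℓ → ℓ₂ ≠ ℓ → Projects ℓ C E → Projects ℓ (.sync ℓ₁ d ℓ₂ C) E
  | defLocal {C₁ C₂ : Chor Loc Expr} {E₁ E₂ : Ctrl Loc Expr} :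
      Projects ℓ C₁ E₁ → Projects ℓ C₂ E₂ → Projects ℓ (.defLocal ℓ C₁ C₂) (.letRet E₁ E₂)
  | defLocalOther {ℓ₁ : Loc} {C₁ C₂ : Chor Loc Expr} {E₁ E₂ : Ctrl Loc Expr} :
      ℓ₁ ≠ ℓ → Projects ℓ C₁ E₁ → Projects ℓ C₂ E₂ →
      Projects ℓ (.defLocal ℓ₁ C₁ C₂) (.appGlobal (.funGlobal (E₂.gren (· + 2))) E₁)
  | funLocal {C : Chor Loc Expr} {E : Ctrl Loc Expr} :
      Projects ℓ C E → Projects ℓ (.funLocal ℓ C) (.funLocal E)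
  | funLocalOther {ℓ₁ : Loc} {C : Chor Loc Expr} {E : Ctrl Loc Expr} :
      ℓ₁ ≠ ℓ → Projects ℓ C E → Projects ℓ (.funLocal ℓ₁ C) (.funGlobal (E.gren (· + 1)))
  | funGlobal {C : Chor Loc Expr} {E : Ctrl Loc Expr} :
      Projects ℓ C E → Projects ℓ (.funGlobal C) (.funGlobal E)
  | appLocal {e : Expr} {C : Chor Loc Expr} {E : Ctrl Loc Expr} :
      Projects ℓ C E → Projects ℓ (.appLocal ℓ C e) (.appLocal E e)
  | appLocalOther {ℓ₁ : Loc} {e : Expr} {C : Chor Loc Expr} {E : Ctrl Loc Expr} :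
      ℓ₁ ≠ ℓ → Projects ℓ C E → Projects ℓ (.appLocal ℓ₁ C e) (.appGlobal E .unit)
  | appGlobal {C₁ C₂ : Chor Loc Expr} {E₁ E₂ : Ctrl Loc Expr} :
      Projects ℓ C₁ E₁ → Projects ℓ C₂ E₂ → Projects ℓ (.appGlobal C₁ C₂) (.appGlobal E₁ E₂)

theorem Projects.proj_eq [DecidableEq Loc] [DecidableEq Expr] {ℓ : Loc} {C : Chor Loc Expr}
    {E : Ctrl Loc Expr} (h : Projects ℓ C E) : C.proj ℓ = some E := by
  induction h with
  | iteOther hne _ _ hm => have := hm.merge_eq; simp_all [Chor.proj]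
  | _ => simp_all [Chor.proj]

theorem projects_of_proj_eq [DecidableEq Loc] [DecidableEq Expr] {ℓ : Loc} (C : Chor Loc Expr) :
    ∀ E, C.proj ℓ = some E → Projects ℓ C E := by
  induction C with
  | var n => rintro E ⟨⟩; exact .var n
  | done ℓ₁ e =>
    intro E h
    by_cases h₁ : ℓ₁ = ℓ <;> simp only [Chor.proj, h₁, if_true, if_false, Option.some.injEq] at h <;>
      subst h
    · subst h₁; exact .done e
    · exact .doneOther e h₁
  | send ℓ₁ e ℓ₂ C ih =>
    intro E h
    by_cases h₁ : ℓ₁ = ℓ <;> by_cases h₂ : ℓ₂ = ℓ <;>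
      simp only [Chor.proj, h₁, h₂, if_true, if_false, Option.map_eq_some_iff, reduceCtorEq] at h
    · obtain ⟨F, hF, rfl⟩ := h; subst h₁; exact .send h₂ (ih F hF)
    · obtain ⟨F, hF, rfl⟩ := h; subst h₂; exact .recv h₁ (ih F hF)
    · exact .sendOther h₁ h₂ (ih E h)
  | ite ℓ₁ e C₁ C₂ ih₁ ih₂ =>
    intro E h
    simp only [Chor.proj, Option.bind_eq_bind, Option.bind_eq_some_iff] at h
    obtain ⟨F₁, hF₁, F₂, hF₂, h⟩ := h
    by_cases h₁ : ℓ₁ = ℓ <;> simp only [h₁, if_true, if_false, Option.some.injEq] at h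
    · subst h; subst h₁; exact .ite (ih₁ _ hF₁) (ih₂ _ hF₂)
    · exact .iteOther h₁ (ih₁ _ hF₁) (ih₂ _ hF₂) (merges_of_merge_eq _ _ _ h)
  | sync ℓ₁ d ℓ₂ C ih =>
    intro E h
    by_cases h₁ : ℓ₁ = ℓ <;> by_cases h₂ : ℓ₂ = ℓ <;> cases d <;>
      simp only [Chor.proj, h₁, h₂, if_true, if_false, Option.map_eq_some_iff, reduceCtorEq] at h
    · obtain ⟨F, hF, rfl⟩ := h; subst h₁; exact .choose h₂ (ih F hF)
    · obtain ⟨F, hF, rfl⟩ := h; subst h₁; exact .choose h₂ (ih F hF)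
    · obtain ⟨F, hF, rfl⟩ := h; subst h₂; exact .allowL h₁ (ih F hF)
    · obtain ⟨F, hF, rfl⟩ := h; subst h₂; exact .allowR h₁ (ih F hF)
    · exact .syncOther h₁ h₂ (ih E h)
    · exact .syncOther h₁ h₂ (ih E h)
  | defLocal ℓ₁ C₁ C₂ ih₁ ih₂ =>
    intro E h
    simp only [Chor.proj, Option.bind_eq_bind, Option.bind_eq_some_iff] at h
    obtain ⟨F₁, hF₁, F₂, hF₂, h⟩ := h
    by_cases h₁ : ℓ₁ = ℓ <;> simp only [h₁, if_true, if_false, Option.some.injEq] at h <;> subst h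
    · subst h₁; exact .defLocal (ih₁ _ hF₁) (ih₂ _ hF₂)
    · exact .defLocalOther h₁ (ih₁ _ hF₁) (ih₂ _ hF₂)
  | funLocal ℓ₁ C ih =>
    intro E h
    by_cases h₁ : ℓ₁ = ℓ <;>
      simp only [Chor.proj, h₁, if_true, if_false, Option.map_eq_some_iff] at h <;>
      obtain ⟨F, hF, rfl⟩ := h
    · subst h₁; exact .funLocal (ih F hF)
    · exact .funLocalOther h₁ (ih F hF)
  | funGlobal C ih =>
    intro E h
    simp only [Chor.proj, Option.map_eq_some_iff] at h
    obtain ⟨F, hF, rfl⟩ := h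
    exact .funGlobal (ih F hF)
  | appLocal ℓ₁ C e ih =>
    intro E h
    by_cases h₁ : ℓ₁ = ℓ <;>
      simp only [Chor.proj, h₁, if_true, if_false, Option.map_eq_some_iff] at h <;>
      obtain ⟨F, hF, rfl⟩ := h
    · subst h₁; exact .appLocal (ih F hF)
    · exact .appLocalOther h₁ (ih F hF)
  | appGlobal C₁ C₂ ih₁ ih₂ =>
    intro E h
    simp only [Chor.proj, Option.bind_eq_bind, Option.bind_eq_some_iff, Option.some.injEq] at h
    obtain ⟨F₁, hF₁, F₂, hF₂, rfl⟩ := h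
    exact .appGlobal (ih₁ _ hF₁) (ih₂ _ hF₂)

/-! ### Projection commutes with substitution -/

namespace Projects

variable [DecidableEq Loc] [LocalLanguage Expr]

/-- Only the component of the family at `ℓ` is visible in the projection. A binder owned by `ℓ`
lifts that component (`same`), and a binder owned elsewhere leaves it alone (`other`). -/
theorem lren {ℓ : Loc} {C : Chor Loc Expr} {E : Ctrl Loc Expr} (h : Projects ℓ C E)
    (ξ : Loc → ℕ → ℕ) : Projects ℓ (C.lren ξ) (E.lren (ξ ℓ)) := by
  have same : ∀ {C : Chor Loc Expr} {E : Ctrl Loc Expr} (ξ : Loc → ℕ → ℕ),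
      (∀ ξ, Projects ℓ (C.lren ξ) (E.lren (ξ ℓ))) →
      Projects ℓ (C.lren (upLocRen ℓ ξ)) (E.lren (upRen (ξ ℓ))) := by
    intro C E ξ ih
    simpa [upLocRen] using ih (upLocRen ℓ ξ)
  have other : ∀ {ℓ₁ : Loc} {C : Chor Loc Expr} {E : Ctrl Loc Expr} (ξ : Loc → ℕ → ℕ), ℓ₁ ≠ ℓ →
      (∀ ξ, Projects ℓ (C.lren ξ) (E.lren (ξ ℓ))) →
      Projects ℓ (C.lren (upLocRen ℓ₁ ξ)) (E.lren (ξ ℓ)) := by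
    intro ℓ₁ C E ξ hne ih
    simpa [upLocRen, hne.symm] using ih (upLocRen ℓ₁ ξ)
  induction h generalizing ξ with
  | var n => exact .var n
  | done e => exact .done _
  | doneOther e hne => exact .doneOther _ hne
  | send hne _ ih => exact .send hne (other ξ hne ih)
  | recv hne _ ih => exact .recv hne (same ξ ih)
  | sendOther h₁ h₂ _ ih => exact .sendOther h₁ h₂ (other ξ h₂ ih)
  | ite _ _ ih₁ ih₂ => exact .ite (ih₁ ξ) (ih₂ ξ)
  | iteOther hne _ _ hm ih₁ ih₂ => exact .iteOther hne (ih₁ ξ) (ih₂ ξ) (hm.lren _)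
  | choose hne _ ih => exact .choose hne (ih ξ)
  | allowL hne _ ih => exact .allowL hne (ih ξ)
  | allowR hne _ ih => exact .allowR hne (ih ξ)
  | syncOther h₁ h₂ _ ih => exact .syncOther h₁ h₂ (ih ξ)
  | defLocal _ _ ih₁ ih₂ => exact .defLocal (ih₁ ξ) (same ξ ih₂)
  | defLocalOther hne _ _ ih₁ ih₂ =>
    simp only [Ctrl.lren, Ctrl.gren_lren]
    exact .defLocalOther hne (ih₁ ξ) (other ξ hne ih₂)
  | funLocal _ ih => exact .funLocal (same ξ ih)
  | funLocalOther hne _ ih =>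
    simp only [Ctrl.lren, Ctrl.gren_lren]
    exact .funLocalOther hne (other ξ hne ih)
  | funGlobal _ ih => exact .funGlobal (ih ξ)
  | appLocal _ ih => exact .appLocal (ih ξ)
  | appLocalOther hne _ ih => exact .appLocalOther hne (ih ξ)
  | appGlobal _ _ ih₁ ih₂ => exact .appGlobal (ih₁ ξ) (ih₂ ξ)

theorem lsubst {ℓ : Loc} {C : Chor Loc Expr} {E : Ctrl Loc Expr} (h : Projects ℓ C E)
    (σ : Loc → ℕ → Expr) : Projects ℓ (C.lsubst σ) (E.lsubst (σ ℓ)) := by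
  have same : ∀ {C : Chor Loc Expr} {E : Ctrl Loc Expr} (σ : Loc → ℕ → Expr),
      (∀ σ, Projects ℓ (C.lsubst σ) (E.lsubst (σ ℓ))) →
      Projects ℓ (C.lsubst (upLocSubst ℓ σ)) (E.lsubst (upSubst (σ ℓ))) := by
    intro C E σ ih
    simpa [upLocSubst] using ih (upLocSubst ℓ σ)
  have other : ∀ {ℓ₁ : Loc} {C : Chor Loc Expr} {E : Ctrl Loc Expr} (σ : Loc → ℕ → Expr), ℓ₁ ≠ ℓ →
      (∀ σ, Projects ℓ (C.lsubst σ) (E.lsubst (σ ℓ))) →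
      Projects ℓ (C.lsubst (upLocSubst ℓ₁ σ)) (E.lsubst (σ ℓ)) := by
    intro ℓ₁ C E σ hne ih
    simpa [upLocSubst, hne.symm] using ih (upLocSubst ℓ₁ σ)
  induction h generalizing σ with
  | var n => exact .var n
  | done e => exact .done _
  | doneOther e hne => exact .doneOther _ hne
  | send hne _ ih => exact .send hne (other σ hne ih)
  | recv hne _ ih => exact .recv hne (same σ ih)
  | sendOther h₁ h₂ _ ih => exact .sendOther h₁ h₂ (other σ h₂ ih)
  | ite _ _ ih₁ ih₂ => exact .ite (ih₁ σ) (ih₂ σ)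
  | iteOther hne _ _ hm ih₁ ih₂ => exact .iteOther hne (ih₁ σ) (ih₂ σ) (hm.lsubst _)
  | choose hne _ ih => exact .choose hne (ih σ)
  | allowL hne _ ih => exact .allowL hne (ih σ)
  | allowR hne _ ih => exact .allowR hne (ih σ)
  | syncOther h₁ h₂ _ ih => exact .syncOther h₁ h₂ (ih σ)
  | defLocal _ _ ih₁ ih₂ => exact .defLocal (ih₁ σ) (same σ ih₂)
  | defLocalOther hne _ _ ih₁ ih₂ =>
    simp only [Ctrl.lsubst, Ctrl.gren_lsubst]
    exact .defLocalOther hne (ih₁ σ) (other σ hne ih₂)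
  | funLocal _ ih => exact .funLocal (same σ ih)
  | funLocalOther hne _ ih =>
    simp only [Ctrl.lsubst, Ctrl.gren_lsubst]
    exact .funLocalOther hne (other σ hne ih)
  | funGlobal _ ih => exact .funGlobal (ih σ)
  | appLocal _ ih => exact .appLocal (ih σ)
  | appLocalOther hne _ ih => exact .appLocalOther hne (ih σ)
  | appGlobal _ _ ih₁ ih₂ => exact .appGlobal (ih₁ σ) (ih₂ σ)

theorem lsubst_single_same {ℓ : Loc} {C : Chor Loc Expr} {E : Ctrl Loc Expr}
    (h : Projects ℓ C E) (e : Expr) :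
    Projects ℓ (C.lsubst (singleLocSubst ℓ e)) (E.lsubst (singleSubst e)) := by
  simpa [singleLocSubst] using h.lsubst (singleLocSubst ℓ e)

/-- A substitution at another location has the identity as its component at `ℓ`. -/
theorem lsubst_single_other {ℓ ℓ₁ : Loc} {C : Chor Loc Expr} {E : Ctrl Loc Expr}
    (h : Projects ℓ C E) (hne : ℓ₁ ≠ ℓ) (e : Expr) :
    Projects ℓ (C.lsubst (singleLocSubst ℓ₁ e)) E := by
  simpa [singleLocSubst, hne.symm, Ctrl.lsubst_var] using h.lsubst (singleLocSubst ℓ₁ e)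

omit [DecidableEq Loc] [LocalLanguage Expr] in
theorem gren {ℓ : Loc} {C : Chor Loc Expr} {E : Ctrl Loc Expr} (h : Projects ℓ C E)
    (ξ : ℕ → ℕ) : Projects ℓ (C.gren ξ) (E.gren ξ) := by
  induction h generalizing ξ with
  | iteOther hne _ _ hm ih₁ ih₂ => exact .iteOther hne (ih₁ ξ) (ih₂ ξ) (hm.gren _)
  | defLocalOther hne _ _ ih₁ ih₂ =>
    -- Renaming and then skipping the two dummy binders is, by unfolding, the same map as skipping
    -- them and then applying `ξ` lifted twice.
    have := Projects.defLocalOther hne (ih₁ ξ) (ih₂ ξ)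
    rw [Ctrl.gren_gren] at this
    simp only [Ctrl.gren, Ctrl.gren_gren]
    exact this
  | funLocalOther hne _ ih =>
    have := Projects.funLocalOther hne (ih (upRen ξ))
    rw [Ctrl.gren_gren] at this
    simp only [Ctrl.gren, Ctrl.gren_gren]
    exact this
  | _ => constructor <;> apply_assumption

/-- The pointwise hypothesis on `σ` and `τ` survives every binder: under a local binder of `ℓ` both
are shifted, under one of another location the shift is invisible at `ℓ`, and under a control binder
both are lifted. -/
theorem gsubst {ℓ : Loc} {C : Chor Loc Expr} {E : Ctrl Loc Expr} (h : Projects ℓ C E)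
    {σ : ℕ → Chor Loc Expr} {τ : ℕ → Ctrl Loc Expr} (hσ : ∀ n, Projects ℓ (σ n) (τ n)) :
    Projects ℓ (C.gsubst σ) (E.gsubst τ) := by
  have same : ∀ {σ : ℕ → Chor Loc Expr} {τ : ℕ → Ctrl Loc Expr},
      (∀ n, Projects ℓ (σ n) (τ n)) → ∀ n, Projects ℓ (Chor.upGLoc ℓ σ n) (Ctrl.upGLoc τ n) := by
    intro σ τ hσ n
    simpa [shiftLoc, Chor.upGLoc, Ctrl.upGLoc] using (hσ n).lren (shiftLoc ℓ)
  have other : ∀ {ℓ₁ : Loc} {σ : ℕ → Chor Loc Expr} {τ : ℕ → Ctrl Loc Expr}, ℓ₁ ≠ ℓ →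
      (∀ n, Projects ℓ (σ n) (τ n)) → ∀ n, Projects ℓ (Chor.upGLoc ℓ₁ σ n) (τ n) := by
    intro ℓ₁ σ τ hne hσ n
    simpa [shiftLoc, Chor.upGLoc, hne.symm, Ctrl.lren_id] using (hσ n).lren (shiftLoc ℓ₁)
  have up : ∀ {σ : ℕ → Chor Loc Expr} {τ : ℕ → Ctrl Loc Expr},
      (∀ n, Projects ℓ (σ n) (τ n)) → ∀ n, Projects ℓ (Chor.upG σ n) (Ctrl.upG τ n) := by
    intro σ τ hσ n
    cases n with
    | zero => exact .var 0
    | succ n => exact (hσ n).gren _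
  induction h generalizing σ τ with
  | var n => exact hσ n
  | done e => exact .done _
  | doneOther e hne => exact .doneOther _ hne
  | send hne _ ih => exact .send hne (ih (other hne hσ))
  | recv hne _ ih => exact .recv hne (ih (same hσ))
  | sendOther h₁ h₂ _ ih => exact .sendOther h₁ h₂ (ih (other h₂ hσ))
  | ite _ _ ih₁ ih₂ => exact .ite (ih₁ hσ) (ih₂ hσ)
  | iteOther hne _ _ hm ih₁ ih₂ => exact .iteOther hne (ih₁ hσ) (ih₂ hσ) (hm.gsubst _)
  | choose hne _ ih => exact .choose hne (ih hσ)
  | allowL hne _ ih => exact .allowL hne (ih hσ)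
  | allowR hne _ ih => exact .allowR hne (ih hσ)
  | syncOther h₁ h₂ _ ih => exact .syncOther h₁ h₂ (ih hσ)
  | defLocal _ _ ih₁ ih₂ => exact .defLocal (ih₁ hσ) (ih₂ (same hσ))
  | defLocalOther hne _ _ ih₁ ih₂ =>
    have := Projects.defLocalOther hne (ih₁ hσ) (ih₂ (other hne hσ))
    rw [Ctrl.gsubst_upG_upG_gren] at this
    exact this
  | funLocal _ ih => exact .funLocal (ih (up (same hσ)))
  | funLocalOther hne _ ih =>
    have := Projects.funLocalOther hne (ih (up (other hne hσ)))
    rw [Ctrl.gsubst_upG_gren] at this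
    exact this
  | funGlobal _ ih => exact .funGlobal (ih (up (up hσ)))
  | appLocal _ ih => exact .appLocal (ih hσ)
  | appLocalOther hne _ ih => exact .appLocalOther hne (ih hσ)
  | appGlobal _ _ ih₁ ih₂ => exact .appGlobal (ih₁ hσ) (ih₂ hσ)

theorem gsubst_single {ℓ : Loc} {C D : Chor Loc Expr} {E F : Ctrl Loc Expr}
    (h : Projects ℓ C E) (hD : Projects ℓ D F) :
    Projects ℓ (C.gsubst (Chor.single D)) (E.gsubst (Ctrl.single F)) :=
  h.gsubst fun n => match n with
    | 0 => hD
    | n + 1 => .var n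

theorem gsubst_double {ℓ : Loc} {C D₀ D₁ : Chor Loc Expr} {E F₀ F₁ : Ctrl Loc Expr}
    (h : Projects ℓ C E) (h₀ : Projects ℓ D₀ F₀) (h₁ : Projects ℓ D₁ F₁) :
    Projects ℓ (C.gsubst (Chor.double D₀ D₁)) (E.gsubst (Ctrl.double F₀ F₁)) :=
  h.gsubst fun n => match n with
    | 0 => h₀
    | 1 => h₁
    | n + 2 => .var n

/-! ### Projections of values -/

/-- Function values must be closed, so bounds on free variables have to pass through projection;
each dummy binder raises the control bound by exactly the shift it introduces. -/
theorem closedBelow {ℓ : Loc} {C : Chor Loc Expr} {E : Ctrl Loc Expr} (h : Projects ℓ C E)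
    {n : Loc → ℕ} {m : ℕ} (hC : C.ClosedBelow n m) : E.ClosedBelow (n ℓ) m := by
  have same : ∀ n : Loc → ℕ, upLocBound ℓ n ℓ = n ℓ + 1 := fun _ => if_pos rfl
  have other : ∀ {ℓ₁ : Loc} (n : Loc → ℕ), ℓ₁ ≠ ℓ → upLocBound ℓ₁ n ℓ = n ℓ :=
    fun _ h => if_neg h.symm
  induction h generalizing n m with
  | var k => exact hC
  | done e => exact hC
  | doneOther e hne => trivial
  | send hne _ ih => have := ih hC.2; rw [other n hne] at this; exact ⟨hC.1, this⟩
  | recv hne _ ih => have := ih hC.2; rw [same] at this; exact this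
  | sendOther h₁ h₂ _ ih => have := ih hC.2; rw [other n h₂] at this; exact this
  | ite _ _ ih₁ ih₂ => exact ⟨hC.1, ih₁ hC.2.1, ih₂ hC.2.2⟩
  | iteOther hne _ _ hm ih₁ ih₂ => exact hm.closedBelow (ih₁ hC.2.1) (ih₂ hC.2.2)
  | choose _ _ ih | allowL _ _ ih | allowR _ _ ih | syncOther _ _ _ ih => exact ih hC
  | defLocal _ _ ih₁ ih₂ => have := ih₂ hC.2; rw [same] at this; exact ⟨ih₁ hC.1, this⟩
  | defLocalOther hne _ _ ih₁ ih₂ =>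
    have := ih₂ hC.2
    rw [other n hne] at this
    exact ⟨Ctrl.gren_closedBelow this fun k hk => Nat.add_lt_add_right hk 2, ih₁ hC.1⟩
  | funLocal _ ih => have := ih hC; rw [same] at this; exact this
  | funLocalOther hne _ ih =>
    have := ih hC
    rw [other n hne] at this
    exact Ctrl.gren_closedBelow this fun k hk => Nat.add_lt_add_right hk 1
  | funGlobal _ ih => exact ih hC
  | appLocal _ ih => exact ⟨ih hC.1, hC.2⟩
  | appLocalOther hne _ ih => exact ⟨ih hC.1, trivial⟩
  | appGlobal _ _ ih₁ ih₂ => exact ⟨ih₁ hC.1, ih₂ hC.2⟩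

theorem value {ℓ : Loc} {V : Chor Loc Expr} {E : Ctrl Loc Expr} (h : Projects ℓ V E)
    (hV : V.Value) : E.Value := by
  cases hV with
  | done ℓ₁ v hv =>
    cases h with
    | done => exact .ret v hv
    | doneOther => exact .unit
  | funLocal ℓ₁ C hC =>
    have := h.closedBelow hC
    cases h with
    | funLocal => exact .funLocal _ this
    | funLocalOther => exact .funGlobal _ this
  | funGlobal C hC =>
    have := h.closedBelow hC
    cases h with
    | funGlobal => exact .funGlobal _ this

end Projects

/-! ### Local completeness -/

/-- Local completeness for the relational projection, with the steps of the control program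
annotated by the redex. -/
theorem ChorStep.exists_projects [DecidableEq Loc] [LocalLanguage Expr] {R : Redex Loc Expr}
    {B : Set Loc} {C₁ C₂ : Chor Loc Expr} (hstep : ChorStep R B C₁ C₂) {ℓ : Loc}
    {E₁ : Ctrl Loc Expr} (hE₁ : Projects ℓ C₁ E₁) :
    ∃ E₂, Projects ℓ C₂ E₂ ∧
      (RedexStep ℓ R E₁ E₂ ∨ (R.proj ℓ = none ∧ LessNondet E₂ E₁)) := by
  -- For a blocked location only the second alternative of the induction hypothesis can hold.
  have blocked : ∀ {R : Redex Loc Expr} {B : Set Loc} {C₁ C₂ : Chor Loc Expr}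
      {E₁ E₂ : Ctrl Loc Expr}, ChorStep R B C₁ C₂ → ℓ ∈ B →
      (RedexStep ℓ R E₁ E₂ ∨ (R.proj ℓ = none ∧ LessNondet E₂ E₁)) →
      R.proj ℓ = none ∧ LessNondet E₂ E₁ := by
    intro R B C₁ C₂ E₁ E₂ hs hℓ h
    rcases h with h | h
    · obtain ⟨l, hl, -⟩ := h.exists_ctrlStep
      rw [hs.proj_eq_none hℓ] at hl
      cases hl
    · exact h
  induction hstep generalizing E₁ with
  | doneE _ hs =>
    cases hE₁ with
    | done => exact ⟨_, .done _, .inl (.done hs)⟩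
    | doneOther _ hne => exact ⟨_, .doneOther _ hne, .inr ⟨if_neg hne, .unit⟩⟩
  | sendE _ hne hs =>
    cases hE₁ with
    | send h₂ hC => exact ⟨_, .send h₂ hC, .inl (.sendE hs)⟩
    | recv h₁ hC => exact ⟨_, .recv h₁ hC, .inr ⟨if_neg h₁, .refl _⟩⟩
    | sendOther h₁ h₂ hC => exact ⟨_, .sendOther h₁ h₂ hC, .inr ⟨if_neg h₁, .refl _⟩⟩
  | sendI hs ih =>
    cases hE₁ with
    | send h₂ hC =>
      obtain ⟨F, hF, h⟩ := ih hC
      -- Here `ℓ` is an endpoint of the skipped communication, hence blocked in the step of the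
      -- continuation.
      obtain ⟨hR, hle⟩ := blocked hs (by simp) h
      exact ⟨_, .send h₂ hF, .inr ⟨hR, .send hle⟩⟩
    | recv h₁ hC =>
      obtain ⟨F, hF, h⟩ := ih hC
      obtain ⟨hR, hle⟩ := blocked hs (by simp) h
      exact ⟨_, .recv h₁ hF, .inr ⟨hR, .recv hle⟩⟩
    | sendOther h₁ h₂ hC =>
      obtain ⟨F, hF, h⟩ := ih hC
      exact ⟨F, .sendOther h₁ h₂ hF, h⟩
  | sendV _ _ hv hne =>
    cases hE₁ with
    | send h₂ hC => exact ⟨_, hC.lsubst_single_other h₂ _, .inl (.sendV hv h₂)⟩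
    | recv h₁ hC => exact ⟨_, hC.lsubst_single_same _, .inl (.recvV hv h₁)⟩
    | sendOther h₁ h₂ hC =>
      exact ⟨_, hC.lsubst_single_other h₂ _, .inr ⟨by simp [Redex.proj, h₁, h₂], .refl _⟩⟩
  | ifE _ hs =>
    cases hE₁ with
    | ite h₁ h₂ => exact ⟨_, .ite h₁ h₂, .inl (.ifE hs)⟩
    | iteOther hne h₁ h₂ hm => exact ⟨_, .iteOther hne h₁ h₂ hm, .inr ⟨if_neg hne, .refl _⟩⟩
  | ifI hs₁ hs₂ ih₁ ih₂ =>
    cases hE₁ with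
    | ite h₁ h₂ =>
      obtain ⟨F₁, hF₁, k₁⟩ := ih₁ h₁
      obtain ⟨F₂, hF₂, k₂⟩ := ih₂ h₂
      obtain ⟨hR, hle₁⟩ := blocked hs₁ (by simp) k₁
      obtain ⟨-, hle₂⟩ := blocked hs₂ (by simp) k₂
      exact ⟨_, .ite hF₁ hF₂, .inr ⟨hR, .ite hle₁ hle₂⟩⟩
    | iteOther hne h₁ h₂ hm =>
      obtain ⟨F₁, hF₁, k₁⟩ := ih₁ h₁
      obtain ⟨F₂, hF₂, k₂⟩ := ih₂ h₂
      rcases k₁ with k₁ | ⟨hR, k₁⟩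
      · rcases k₂ with k₂ | ⟨hR, k₂⟩
        -- The uninvolved location demanded by `RedexStep.merges` is the one deciding the
        -- conditional, which is blocked in both branches.
        · obtain ⟨F, hF, k⟩ := k₁.merges (hs₁.proj_eq_none (.inr rfl)) k₂ hm
          exact ⟨F, .iteOther hne hF₁ hF₂ hF, .inl k⟩
        -- Both branches use the same redex, so `ℓ` cannot take part in one and not in the other.
        · obtain ⟨l, hl, -⟩ := k₁.exists_ctrlStep
          simp [hR] at hl
      · rcases k₂ with k₂ | ⟨-, k₂⟩
        · obtain ⟨l, hl, -⟩ := k₂.exists_ctrlStep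
          simp [hR] at hl
        -- The old merge bounds both new projections from above, so their merge exists and lies
        -- below it.
        · obtain ⟨F, hF, k⟩ := (k₁.trans hm.left_le).exists_merges (k₂.trans hm.right_le)
          exact ⟨F, .iteOther hne hF₁ hF₂ hF, .inr ⟨hR, k⟩⟩
  | ifT =>
    cases hE₁ with
    | ite h₁ h₂ => exact ⟨_, h₁, .inl .ifT⟩
    | iteOther hne h₁ h₂ hm => exact ⟨_, h₁, .inr ⟨if_neg hne, hm.left_le⟩⟩
  | ifF =>
    cases hE₁ with
    | ite h₁ h₂ => exact ⟨_, h₂, .inl .ifF⟩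
    | iteOther hne h₁ h₂ hm => exact ⟨_, h₂, .inr ⟨if_neg hne, hm.right_le⟩⟩
  | defLocalI hs ih =>
    cases hE₁ with
    | defLocal h₁ h₂ =>
      obtain ⟨F, hF, k | ⟨hR, k⟩⟩ := ih h₁
      · exact ⟨_, .defLocal hF h₂, .inl (.letRetArg k)⟩
      · exact ⟨_, .defLocal hF h₂, .inr ⟨by simp [Redex.proj, hR], .letRet k (.refl _)⟩⟩
    | defLocalOther hne h₁ h₂ =>
      obtain ⟨F, hF, k | ⟨hR, k⟩⟩ := ih h₁
      · exact ⟨_, .defLocalOther hne hF h₂, .inl (.appGlobalArg k)⟩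
      · exact ⟨_, .defLocalOther hne hF h₂,
          .inr ⟨by simp [Redex.proj, hR], .appGlobal (.refl _) k⟩⟩
  | defLocal hv =>
    cases hE₁ with
    | defLocal h₁ h₂ =>
      cases h₁ with
      | done => exact ⟨_, h₂.lsubst_single_same _, .inl (.defLocal (.letRet hv))⟩
      | doneOther _ hne => exact absurd rfl hne
    | @defLocalOther _ _ _ _ E hne h₁ h₂ =>
      cases h₁ with
      | done => exact absurd rfl hne
      | doneOther =>
        refine ⟨_, h₂.lsubst_single_other hne _, .inl (.defLocal ?_)⟩
        -- At an uninvolved location the bound choreography projects to `unit`, itself a value. The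
        -- reduction substitutes only for the two dummy variables, and after the shift by two this
        -- is the identity substitution.
        have := CtrlStep.appGlobal (Loc := Loc) (E := E.gren (· + 2)) .unit
        rw [Ctrl.gren_gsubst] at this
        exact Eq.mp (congrArg _ (Ctrl.gsubst_var E)) this
  | appLocalFun hs ih =>
    cases hE₁ with
    | appLocal h₁ =>
      obtain ⟨F, hF, k | ⟨hR, k⟩⟩ := ih h₁
      · exact ⟨_, .appLocal hF, .inl (.appLocalFun k)⟩
      · exact ⟨_, .appLocal hF, .inr ⟨by simp [Redex.proj, hR], .appLocal k⟩⟩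
    | appLocalOther hne h₁ =>
      obtain ⟨F, hF, k | ⟨hR, k⟩⟩ := ih h₁
      · exact ⟨_, .appLocalOther hne hF, .inl (.appGlobalFun k)⟩
      · exact ⟨_, .appLocalOther hne hF, .inr ⟨by simp [Redex.proj, hR], .appGlobal k .unit⟩⟩
  | appLocalArg _ hs =>
    cases hE₁ with
    | appLocal h₁ => exact ⟨_, .appLocal h₁, .inl (.appLocalArg hs)⟩
    | appLocalOther hne h₁ => exact ⟨_, .appLocalOther hne h₁, .inr ⟨if_neg hne, .refl _⟩⟩
  | appLocal hv =>
    cases hE₁ with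
    | appLocal h =>
      cases h with
      | funLocal hC =>
        exact ⟨_, (hC.lsubst_single_same _).gsubst_single (.funLocal hC),
          .inl (.appLocal (.appLocal hv))⟩
      | funLocalOther hne => exact absurd rfl hne
    | appLocalOther hne h =>
      cases h with
      | funLocal => exact absurd rfl hne
      | @funLocalOther _ _ E _ hC =>
        refine ⟨_, (hC.lsubst_single_other hne _).gsubst_single (.funLocalOther hne hC),
          .inl (.appLocal ?_)⟩
        -- Index `0` is the dummy argument, which receives `unit`, and index `1` is the function.
        -- After the shift by one, the double substitution becomes the single substitution of the
        -- function for its own name.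
        have := CtrlStep.appGlobal (Loc := Loc) (E := E.gren (· + 1)) .unit
        rw [Ctrl.gren_gsubst] at this
        convert this using 2
        funext n
        cases n <;> rfl
  | appGlobalFun hs ih =>
    cases hE₁ with
    | appGlobal h₁ h₂ =>
      obtain ⟨F, hF, k | ⟨hR, k⟩⟩ := ih h₁
      · exact ⟨_, .appGlobal hF h₂, .inl (.appGlobalFun k)⟩
      · exact ⟨_, .appGlobal hF h₂, .inr ⟨by simp [Redex.proj, hR], .appGlobal k (.refl _)⟩⟩
  | appGlobalArg hs ih =>
    cases hE₁ with
    | appGlobal h₁ h₂ =>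
      obtain ⟨F, hF, k | ⟨hR, k⟩⟩ := ih h₂
      · exact ⟨_, .appGlobal h₁ hF, .inl (.appGlobalArg k)⟩
      · exact ⟨_, .appGlobal h₁ hF, .inr ⟨by simp [Redex.proj, hR], .appGlobal (.refl _) k⟩⟩
  | appGlobal hV =>
    cases hE₁ with
    | appGlobal h₁ h₂ =>
      cases h₁ with
      | funGlobal hC =>
        -- The projected argument must itself be a value for the control program to reduce.
        exact ⟨_, hC.gsubst_double h₂ (.funGlobal hC),
          .inl (.appGlobal (.appGlobal (h₂.value hV)))⟩
  | syncI hs ih =>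
    cases hE₁ with
    | choose h₂ hC =>
      obtain ⟨F, hF, h⟩ := ih hC
      obtain ⟨hR, hle⟩ := blocked hs (by simp) h
      exact ⟨_, .choose h₂ hF, .inr ⟨hR, .choose hle⟩⟩
    | allowL h₁ hC =>
      obtain ⟨F, hF, h⟩ := ih hC
      obtain ⟨hR, hle⟩ := blocked hs (by simp) h
      exact ⟨_, .allowL h₁ hF, .inr ⟨hR, .allowL hle⟩⟩
    | allowR h₁ hC =>
      obtain ⟨F, hF, h⟩ := ih hC
      obtain ⟨hR, hle⟩ := blocked hs (by simp) h
      exact ⟨_, .allowR h₁ hF, .inr ⟨hR, .allowR hle⟩⟩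
    | syncOther h₁ h₂ hC =>
      obtain ⟨F, hF, h⟩ := ih hC
      exact ⟨F, .syncOther h₁ h₂ hF, h⟩
  | sync _ _ hne =>
    cases hE₁ with
    | choose h₂ hC => exact ⟨_, hC, .inl (.choose h₂)⟩
    | allowL h₁ hC => exact ⟨_, hC, .inl (.allowL h₁)⟩
    | allowR h₁ hC => exact ⟨_, hC, .inl (.allowR h₁)⟩
    | syncOther h₁ h₂ hC => exact ⟨_, hC, .inr ⟨by simp [Redex.proj, h₁, h₂], .refl _⟩⟩

end Pirouette

theorem mainTheorem5 {Loc : Type*} {Expr : Type*} [DecidableEq Loc] [DecidableEq Expr]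
    [Pirouette.LocalLanguage Expr]
    (R : Pirouette.Redex Loc Expr) (B : Set Loc) (C₁ C₂ : Pirouette.Chor Loc Expr)
    (hstep : Pirouette.ChorStep R B C₁ C₂)
    (ℓ : Loc) (E₁ : Pirouette.Ctrl Loc Expr) (hE₁ : C₁.proj ℓ = some E₁) :
    ∃ E₂ : Pirouette.Ctrl Loc Expr, C₂.proj ℓ = some E₂ ∧
      ((∃ l : Pirouette.Label Loc Expr, R.proj ℓ = some l ∧ Pirouette.CtrlStep l E₁ E₂) ∨
        (R.proj ℓ = none ∧ Pirouette.LessNondet E₂ E₁)) := by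
  obtain ⟨E₂, hE₂, h⟩ := hstep.exists_projects (Pirouette.projects_of_proj_eq C₁ E₁ hE₁)
  refine ⟨E₂, hE₂.proj_eq, ?_⟩
  rcases h with h | h
  · exact .inl h.exists_ctrlStep
  · exact .inr h
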